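/- Let $d\ge 1$, and for $k\in\mathbb{Z}^d$ put $|k|=|k_1|+\dots+|k_d|$. Let $(e_n)_{n\in\mathbb{Z}^d}$ be the canonical basis of $\ell^2(\mathbb{Z}^d)$, let $(\lambda_n)_{n\in\mathbb{Z}^d}$ be pairwise distinct real numbers, and let $T$ be the self-adjoint diagonal operator $(Tv)_n=\lambda_n v_n$ with domain $D(T)=\{v\in\ell^2(\mathbb{Z}^d):\sum_n\lambda_n^2|v_n|^2<\infty\}$. Let $V$ be a bounded operator on $\ell^2(\mathbb{Z}^d)$, not necessarily self-adjoint, with matrix elements $V_{m,n}=\langle e_m,Ve_n\rangle$. Assume that there are $c\ge 1$, $\gamma>0$ and $\alpha>0$ such that for all $k\in\mathbb{Z}^d\setminus\{0\}$ $$\sup_{n}\frac{1}{|\lambda_{n+k}-\lambda_n|}\le c\,|k|^{\gamma},\qquad \sup_{n}\frac{1}{|\lambda_{n+k}-\lambda_n|}\le c\Big(1+\frac1{|\lambda_k-\lambda_0|}\Big),$$ $$\sup_{n,\;j\ne0}\left|\frac{1}{\lambda_j-\lambda_0}\Big(\frac1{\lambda_{n+j+k}-\lambda_{n+j}}-\frac1{\lambda_{n+k}-\lambda_n}\Big)\right|\le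 c\Big(1+\frac1{|\lambda_k-\lambda_0|}\Big),$$ and $$\|V\|_\alpha:=\sup_{k\in\mathbb{Z}^d}e^{\alpha|k|}\left(\sup_{m}|V_{m,m+k}|+\sup_{m,\;j\neq0}\left|\frac{V_{m+j,m+j+k}-V_{m,m+k}}{\lambda_j-\lambda_0}\right|\right)<\infty .$$ Let $\sigma=\min\{1,\alpha/2\}$, $g=(2\gamma/e)^{2\gamma}$ and $$A=\frac{1}{12c^2\,g\,4^{4d+2\gamma}}\min\left\{\frac{2^{4(2d+\gamma)}\,3c\,g}{1+2^{4(2d+\gamma)}\,3c\,g},\;1-\frac{3^d}{2^{6d-1}}\right\}.$$ Then there is $\varepsilon^*>0$, namely $\varepsilon^*=A\,\sigma^{4d+2\gamma}/\|V\|_\alpha$ if $V\neq0$, such that for all $\varepsilon\in\mathbb{R}$ with $|\varepsilon|\le\varepsilon^*$, writing $T(\varepsilon)=T+\varepsilon V$ on $D(T)$: 1. The spectrum of $T(\varepsilon)$ is pure point (the eigenvectors span a dense subspace and the spectrum is the closure of the set of eigenvalues) and simple (each eigenvalue is geometrically and algebraically simple). The eigenvalues form a family of pairwise distinct complex numbers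 $(\lambda_n(\varepsilon))_{n\in\mathbb{Z}^d}$ with $$\frac{1}{|\lambda_m(\varepsilon)-\lambda_n(\varepsilon)|}\le 12c^2|m-n|^{2\gamma}\qquad\text{for all } m\ne n.$$ 2. There is a bounded operator $U$ on $\ell^2(\mathbb{Z}^d)$ with bounded inverse such that $U^{-1}(T+\varepsilon V)U=T^{(\infty)}$, with equality of domains, where $T^{(\infty)}$ is the diagonal operator with $T^{(\infty)}e_n=\lambda_n(\varepsilon)e_n$ on its maximal domain. 3. If moreover $V^*=V$, then $U$ can be taken unitary, and $T(\varepsilon)$ has a complete orthonormal system of eigenvectors $u_n(\varepsilon)=Ue_n$, with eigenvalues $\lambda_n(\varepsilon)$, such that for every $n$ there is $C_n>0$ with $$|\langle e_j,u_n(\varepsilon)\rangle|\le C_n e^{-(\alpha-\sigma)|j-n|}\qquad\text{for all } j\in\mathbb{Z}^d .$$ -/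

import Mathlib

open scoped ENNReal

noncomputable section

namespace PurePoint

/-- The lattice `ℤ^d`. -/
abbrev Lattice (d : ℕ) : Type := Fin d → ℤ

/-- `|k| = |k_1| + ⋯ + |k_d|`. -/
def oneNorm {d : ℕ} (k : Lattice d) : ℝ := ∑ i, |(k i : ℝ)|

/-- The complex Hilbert space `ℓ²(ℤ^d)`. -/
abbrev EllTwo (d : ℕ) : Type := lp (fun _ : Lattice d => ℂ) 2

/-- The canonical basis vector `e_n`. -/
def e {d : ℕ} (n : Lattice d) : EllTwo d := lp.single 2 n (1 : ℂ)

/-- The matrix element `A_{m,n} = ⟨e_m, A e_n⟩`. -/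
def entry {d : ℕ} (A : EllTwo d →L[ℂ] EllTwo d) (m n : Lattice d) : ℂ :=
  inner ℂ (e m) (A (e n))

/-- The (in general unbounded) diagonal operator with eigenvalues `μ`, on its maximal domain:
`D = {v ∈ ℓ² : ∑ |μ_n|² |v_n|² < ∞}`, `(D v)_n = μ_n v_n`. -/
def diagOp {d : ℕ} (μ : Lattice d → ℂ) : EllTwo d →ₗ.[ℂ] EllTwo d where
  domain :=
    { carrier := {v | Memℓp (fun n => μ n * v n) 2}
      add_mem' := by
        intro v w hv hw
        have h := Memℓp.add (E := fun _ : Lattice d => ℂ) hv hw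
        have heq : (fun n => μ n * (v + w : EllTwo d) n)
            = (fun n => μ n * v n) + (fun n => μ n * w n) := by
          funext n
          simp [mul_add]
        show Memℓp (fun n => μ n * (v + w : EllTwo d) n) 2
        rw [heq]
        exact h
      zero_mem' := by
        have heq : (fun n => μ n * (0 : EllTwo d) n) = (0 : Lattice d → ℂ) := by
          funext n
          simp
        show Memℓp (fun n => μ n * (0 : EllTwo d) n) 2
        rw [heq]
        exact zero_memℓp
      smul_mem' := by
        intro a v hv
        have h := Memℓp.const_smul (E := fun _ : Lattice d => ℂ) hv a
        have heq : (fun n => μ n * (a • v : EllTwo d) n) = a • (fun n => μ n * v n) := by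
          funext n
          simp [mul_left_comm]
        show Memℓp (fun n => μ n * (a • v : EllTwo d) n) 2
        rw [heq]
        exact h }
  toFun :=
    { toFun := fun v => ⟨fun n => μ n * (v : EllTwo d) n, v.2⟩
      map_add' := by
        intro v w
        ext n
        exact mul_add (μ n) ((v : EllTwo d) n) ((w : EllTwo d) n)
      map_smul' := by
        intro a v
        ext n
        simp [mul_left_comm] }

/-- The operator `T + ε V` on the domain of `T`. -/
def perturbed {d : ℕ} (T : EllTwo d →ₗ.[ℂ] EllTwo d) (V : EllTwo d →L[ℂ] EllTwo d) (ε : ℝ) :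
    EllTwo d →ₗ.[ℂ] EllTwo d where
  domain := T.domain
  toFun := T.toFun + (ε : ℂ) • ((V : EllTwo d →ₗ[ℂ] EllTwo d).comp T.domain.subtype)

/-- The operator `U⁻¹ A U` on its natural domain `{x : U x ∈ D(A)}`. -/
def conj {d : ℕ} (U : EllTwo d ≃L[ℂ] EllTwo d) (A : EllTwo d →ₗ.[ℂ] EllTwo d) :
    EllTwo d →ₗ.[ℂ] EllTwo d where
  domain := A.domain.comap (U : EllTwo d →ₗ[ℂ] EllTwo d)
  toFun := (U.symm : EllTwo d →ₗ[ℂ] EllTwo d).comp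
    (A.toFun.comp ((U : EllTwo d →ₗ[ℂ] EllTwo d).restrict
      (p := A.domain.comap (U : EllTwo d →ₗ[ℂ] EllTwo d)) (q := A.domain) (fun _ hx => hx)))

/-- `ker (A - z)`, as a subspace of `ℓ²(ℤ^d)`. -/
def eigenspace {d : ℕ} (A : EllTwo d →ₗ.[ℂ] EllTwo d) (z : ℂ) : Submodule ℂ (EllTwo d) :=
  (LinearMap.ker (A.toFun - z • A.domain.subtype)).map A.domain.subtype

/-- The set of eigenvalues of an unbounded operator. -/
def eigenvalues {d : ℕ} (A : EllTwo d →ₗ.[ℂ] EllTwo d) : Set ℂ :=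
  {z | eigenspace A z ≠ ⊥}

/-- The spectrum of an unbounded operator: the set of `z` such that `A - z : D(A) → ℓ²(ℤ^d)` has
no bounded two-sided inverse. -/
def spectrum {d : ℕ} (A : EllTwo d →ₗ.[ℂ] EllTwo d) : Set ℂ :=
  {z | ¬ ∃ R : EllTwo d →L[ℂ] EllTwo d,
    (∀ y, ∃ h : R y ∈ A.domain, A ⟨R y, h⟩ - z • R y = y) ∧
    (∀ x : A.domain, R (A x - z • (x : EllTwo d)) = x)}

/-- Pure point spectrum (the operator need not be self-adjoint): the eigenvectors span a dense
subspace, and the spectrum is the closure of the set of eigenvalues. -/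
def HasPurePointSpectrum {d : ℕ} (A : EllTwo d →ₗ.[ℂ] EllTwo d) : Prop :=
  (⨆ z : ℂ, eigenspace A z).topologicalClosure = ⊤ ∧ spectrum A = closure (eigenvalues A)

/-- All eigenvalues are simple, geometrically (one-dimensional eigenspaces) and algebraically
(no generalized eigenvectors besides eigenvectors). -/
def HasSimpleEigenvalues {d : ℕ} (A : EllTwo d →ₗ.[ℂ] EllTwo d) : Prop :=
  ∀ z ∈ eigenvalues A, Module.finrank ℂ (eigenspace A z) = 1 ∧
    ∀ x : A.domain, A x - z • (x : EllTwo d) ∈ eigenspace A z → (x : EllTwo d) ∈ eigenspace A z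

/-- `‖A‖_α = sup_k e^{α|k|} ( sup_m |A_{m,m+k}|
  + sup_{m, j ≠ 0} |(A_{m+j,m+j+k} - A_{m,m+k}) / (λ_j - λ_0)| )`, with values in `[0, ∞]`. -/
def shapeNorm {d : ℕ} (lam : Lattice d → ℝ) (α : ℝ) (A : EllTwo d →L[ℂ] EllTwo d) : ℝ≥0∞ :=
  ⨆ k : Lattice d, ENNReal.ofReal (Real.exp (α * oneNorm k)) *
    ((⨆ m : Lattice d, ‖entry A m (m + k)‖ₑ) +
      ⨆ (m : Lattice d) (j : Lattice d) (_ : j ≠ 0),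
        ‖(entry A (m + j) (m + j + k) - entry A m (m + k)) / ((lam j - lam 0 : ℝ) : ℂ)‖ₑ)

/-- `g = (2γ/e)^{2γ}`. -/
def gConst (γ : ℝ) : ℝ := (2 * γ / Real.exp 1) ^ (2 * γ)

/-- The constant
`A = 1 / (12 c² g 4^{4d+2γ}) * min { 2^{4(2d+γ)} 3 c g / (1 + 2^{4(2d+γ)} 3 c g), 1 - 3^d / 2^{6d-1} }`
with `g = (2γ/e)^{2γ}`. -/
def aConst (d : ℕ) (c γ : ℝ) : ℝ :=
  1 / (12 * c ^ 2 * gConst γ * (4 : ℝ) ^ (4 * (d : ℝ) + 2 * γ)) *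
    min ((2 : ℝ) ^ (4 * (2 * (d : ℝ) + γ)) * 3 * c * gConst γ /
          (1 + (2 : ℝ) ^ (4 * (2 * (d : ℝ) + γ)) * 3 * c * gConst γ))
        (1 - (3 : ℝ) ^ d / (2 : ℝ) ^ (6 * (d : ℤ) - 1))

end PurePoint

end

open scoped ENNReal
open Filter Topology

noncomputable section

namespace PurePoint

variable {d : ℕ}

/-! The proof is a KAM iteration on the matrix of the operator. Suppose `T + V` (with the coupling
absorbed into `V`) has been conjugated to `T + D + P`, with `D` diagonal and `P` small. Let `D'` be
the diagonal part of `P`, and solve the homological equation `[T + D, W] = D' - P` entry by entry,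
dividing by differences of the current eigenvalues. Then `(T + D + P)(1 + W) = (1 + W)(T + D + D' +
P')` with `(1 + W) P' = P W - W D'`, so `P'` is quadratic in `P`. The product of the factors `1 + W`
converges to the required `U`, and the sum of the corrections `D'` to a bounded diagonal operator.

Three points make this work. Matrices are measured diagonal by diagonal in `seqNorm`, a translation
invariant algebra norm on sequences that also controls difference quotients with respect to `lam`. A
correction with `seqNorm` at most `1 / (4 * c)` therefore keeps all eigenvalue gaps at least half as
large as before (`IsDiophantine.abs_sub_le`), and the reciprocal gaps along the `k`-th diagonal have
`seqNorm` at most `12 * c ^ 2 * oneNorm k ^ (2 * γ)` (`IsDiophantine.seqNorm_inv_le`). Giving up a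
little exponential weight `δ` pays for this polynomial factor and for passing from suprema to sums
over diagonals. Since a step costs only a power of `1 / δ` and gains a square, widths `δ` that halve
at each step are affordable, and a geometrically decreasing bound on `P` closes the induction
(`IsDiophantine.exists_step`, `step_bounds`, `IsDiophantine.exists_conjugation`).

As `T` is unbounded, `(T + V) U = U (T + D)` is first obtained only for matrix elements, as a
bounded commutator `[T, U] = U D - V U`. A resolvent argument (`IsCommutator.memℓp_iff`) shows that
`U` maps the domain of `T` onto itself, which gives an equality of unbounded operators
(`IsCommutator.conj_eq`). The spectral statements are then read off the diagonal operator. For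
self-adjoint `V` the columns of `U` are eigenvectors for distinct eigenvalues, hence orthogonal, and
normalizing them makes `U` unitary without destroying their decay. -/

/-! ### Matrix elements and operators built from diagonals. -/

theorem e_apply (n m : Lattice d) : (e n : EllTwo d) m = if m = n then 1 else 0 := by
  rw [e, lp.single_apply, Pi.single_apply]

theorem norm_e (n : Lattice d) : ‖(e n : EllTwo d)‖ = 1 := by
  rw [e, lp.norm_single (by norm_num)]; simp

theorem inner_e_left (n : Lattice d) (v : EllTwo d) : inner ℂ (e n) v = v n := by
  rw [e, lp.inner_single_left]; simp

theorem entry_eq (A : EllTwo d →L[ℂ] EllTwo d) (m n : Lattice d) : entry A m n = A (e n) m :=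
  inner_e_left m _

theorem entry_add (A B : EllTwo d →L[ℂ] EllTwo d) (m n : Lattice d) :
    entry (A + B) m n = entry A m n + entry B m n := by simp [entry_eq]

theorem entry_sub (A B : EllTwo d →L[ℂ] EllTwo d) (m n : Lattice d) :
    entry (A - B) m n = entry A m n - entry B m n := by simp [entry_eq]

theorem entry_smul (z : ℂ) (A : EllTwo d →L[ℂ] EllTwo d) (m n : Lattice d) :
    entry (z • A) m n = z * entry A m n := by simp [entry_eq]

theorem entry_one (m n : Lattice d) :
    entry (1 : EllTwo d →L[ℂ] EllTwo d) m n = if m = n then 1 else 0 := by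
  simp [entry_eq, e_apply]

theorem hasSum_e (v : EllTwo d) : HasSum (fun n => v n • (e n : EllTwo d)) v := by
  convert lp.hasSum_single (E := fun _ : Lattice d => ℂ) (p := 2) (by norm_num) v using 2 with n
  rw [e, ← lp.single_smul]; simp

theorem hasSum_apply (A : EllTwo d →L[ℂ] EllTwo d) (v : EllTwo d) (m : Lattice d) :
    HasSum (fun l => entry A m l * v l) (A v m) := by
  have h := ((innerSL ℂ (e m : EllTwo d)).comp A).hasSum (hasSum_e v)
  simpa [inner_e_left, entry_eq, mul_comm] using h

theorem entry_mul_hasSum (A B : EllTwo d →L[ℂ] EllTwo d) (m n : Lattice d) :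
    HasSum (fun l => entry A m l * entry B l n) (entry (A * B) m n) := by
  simpa [entry_eq] using hasSum_apply A (B (e n)) m

theorem ext_entry {A B : EllTwo d →L[ℂ] EllTwo d} (h : ∀ m n, entry A m n = entry B m n) :
    A = B := by
  ext v m
  refine (hasSum_apply A v m).unique ?_
  simpa only [h] using hasSum_apply B v m

/-- Matrix elements depend continuously on the operator. -/
theorem continuous_entry (m n : Lattice d) :
    Continuous fun A : EllTwo d →L[ℂ] EllTwo d => entry A m n := by
  unfold entry; fun_prop

theorem norm_sq_hasSum (v : EllTwo d) : HasSum (fun n => ‖v n‖ ^ 2) (‖v‖ ^ 2) := by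
  have h := lp.hasSum_norm (p := 2) (by norm_num) v
  simpa using h

/-- The weighted shift `(A v)_m = a_m v_{m+k}`. -/
theorem exists_weightedShift (k : Lattice d) (a : Lattice d → ℂ) (C : ℝ) (h : ∀ m, ‖a m‖ ≤ C) :
    ∃ A : EllTwo d →L[ℂ] EllTwo d, (∀ v m, A v m = a m * v (m + k)) ∧ ‖A‖ ≤ C := by
  have hC : 0 ≤ C := (norm_nonneg _).trans (h 0)
  have key : ∀ v : EllTwo d, HasSum (fun m => C ^ 2 * ‖v (m + k)‖ ^ 2) (C ^ 2 * ‖v‖ ^ 2) := by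
    intro v
    exact (((Equiv.addRight k).hasSum_iff).2 (norm_sq_hasSum v)).mul_left (C ^ 2)
  have le : ∀ (v : EllTwo d) m, ‖a m * v (m + k)‖ ^ 2 ≤ C ^ 2 * ‖v (m + k)‖ ^ 2 := by
    intro v m
    rw [norm_mul, mul_pow]
    gcongr
    exact h m
  have mem : ∀ v : EllTwo d, Memℓp (fun m => a m * v (m + k)) 2 := by
    intro v
    refine memℓp_gen ?_
    simpa using Summable.of_nonneg_of_le (fun m => by positivity) (le v) (key v).summable
  let A₀ : EllTwo d →ₗ[ℂ] EllTwo d :=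
    { toFun := fun v => ⟨fun m => a m * v (m + k), mem v⟩
      map_add' := fun v w => by ext m; exact mul_add _ _ _
      map_smul' := fun z v => by ext m; simp [mul_left_comm] }
  have bound : ∀ v, ‖A₀ v‖ ≤ C * ‖v‖ := by
    intro v
    refine le_of_sq_le_sq ?_ (by positivity)
    rw [mul_pow]
    exact hasSum_le (le v) (norm_sq_hasSum (A₀ v)) (key v)
  exact ⟨A₀.mkContinuous C bound, fun v m => rfl, LinearMap.mkContinuous_norm_le _ hC _⟩

/-- An operator with prescribed diagonals, if these are summable in the supremum norm. -/
theorem exists_ofDiagonals (w : Lattice d → Lattice d → ℂ) (b : Lattice d → ℝ) (hb : Summable b)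
    (h : ∀ k m, ‖w k m‖ ≤ b k) :
    ∃ A : EllTwo d →L[ℂ] EllTwo d, (∀ k m, entry A m (m + k) = w k m) ∧ ‖A‖ ≤ ∑' k, b k := by
  choose S hS hSn using fun k => exists_weightedShift k (w k) (b k) (h k)
  have hs : Summable fun k => ‖S k‖ := hb.of_nonneg_of_le (fun _ => norm_nonneg _) hSn
  refine ⟨∑' k, S k, fun k m => ?_, (norm_tsum_le_tsum_norm hs).trans (hs.tsum_le_tsum hSn hb)⟩
  have hsum := hs.of_norm.hasSum
  have h1 : HasSum (fun i => entry (S i) m (m + k)) (entry (∑' k, S k) m (m + k)) :=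
    ((innerSL ℂ (e m : EllTwo d)).comp
      (ContinuousLinearMap.apply ℂ (EllTwo d) (e (m + k) : EllTwo d))).hasSum hsum
  refine h1.unique ((hasSum_ite_eq k (w k m)).congr_fun fun i => ?_)
  rw [entry_eq, hS, e_apply]
  by_cases hi : i = k
  · simp [hi]
  · simp [hi]

/-- `f` is the diagonal sequence of a bounded diagonal operator. -/
theorem exists_diagonal (a : Lattice d → ℂ) (C : ℝ) (h : ∀ m, ‖a m‖ ≤ C) :
    ∃ A : EllTwo d →L[ℂ] EllTwo d, (∀ v m, A v m = a m * v m) ∧ ‖A‖ ≤ C := by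
  simpa using exists_weightedShift 0 a C h

theorem entry_of_apply {A : EllTwo d →L[ℂ] EllTwo d} {a : Lattice d → ℂ}
    (h : ∀ v m, A v m = a m * v m) (m n : Lattice d) : entry A m n = if m = n then a m else 0 := by
  simp [entry_eq, h, e_apply]

/-! ### Diagonal operators and commutators with the unbounded diagonal operator. -/

/-- All off-diagonal matrix elements vanish. -/
def IsDiagonal (A : EllTwo d →L[ℂ] EllTwo d) : Prop := ∀ m n, m ≠ n → entry A m n = 0

theorem IsDiagonal.apply {A : EllTwo d →L[ℂ] EllTwo d} (h : IsDiagonal A) (v : EllTwo d)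
    (m : Lattice d) : A v m = entry A m m * v m :=
  (hasSum_apply A v m).unique (hasSum_single m fun l hl => by simp [h m l hl.symm])

theorem IsDiagonal.entry_mul {A : EllTwo d →L[ℂ] EllTwo d} (h : IsDiagonal A)
    (B : EllTwo d →L[ℂ] EllTwo d) (m n : Lattice d) :
    entry (A * B) m n = entry A m m * entry B m n := by
  rw [entry_eq, mul_apply_eq_comp, h.apply, entry_eq B]

theorem IsDiagonal.mul_entry {A : EllTwo d →L[ℂ] EllTwo d} (h : IsDiagonal A)
    (B : EllTwo d →L[ℂ] EllTwo d) (m n : Lattice d) :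
    entry (B * A) m n = entry B m n * entry A n n :=
  (entry_mul_hasSum B A m n).unique (hasSum_single n fun l hl => by simp [h l n hl])

/-- `B` is the commutator of the diagonal operator with eigenvalues `lam` with `U`. -/
def IsCommutator (lam : Lattice d → ℝ) (U B : EllTwo d →L[ℂ] EllTwo d) : Prop :=
  ∀ m n, ((lam m : ℂ) - lam n) * entry U m n = entry B m n

theorem isCommutator_one (lam : Lattice d → ℝ) : IsCommutator lam 1 0 := by
  intro m n
  rw [entry_one]
  split_ifs with h <;> simp [h, entry_eq]

theorem IsCommutator.add {lam : Lattice d → ℝ} {U B U' B' : EllTwo d →L[ℂ] EllTwo d}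
    (h : IsCommutator lam U B) (h' : IsCommutator lam U' B') :
    IsCommutator lam (U + U') (B + B') := fun m n => by
  rw [entry_add, entry_add, ← h, ← h', mul_add]

theorem IsCommutator.mul {lam : Lattice d → ℝ} {U B U' B' : EllTwo d →L[ℂ] EllTwo d}
    (h : IsCommutator lam U B) (h' : IsCommutator lam U' B') :
    IsCommutator lam (U * U') (B * U' + U * B') := fun m n => by
  rw [entry_add]
  refine ((entry_mul_hasSum U U' m n).mul_left _).unique ?_
  refine ((entry_mul_hasSum B U' m n).add (entry_mul_hasSum U B' m n)).congr_fun fun l => ?_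
  rw [← h, ← h']; ring

theorem IsDiagonal.isCommutator {A : EllTwo d →L[ℂ] EllTwo d} (h : IsDiagonal A)
    (lam : Lattice d → ℝ) : IsCommutator lam A 0 := fun m n => by
  by_cases hmn : m = n
  · simp [hmn, entry_eq]
  · simp [h m n hmn, entry_eq 0]

/-! ### The Banach algebra norm on sequences. -/

/-- The supremum norm of a sequence. -/
def supNorm (f : Lattice d → ℂ) : ℝ≥0∞ := ⨆ m, ‖f m‖ₑ

/-- The seminorm of difference quotients of a sequence with respect to `lam`. -/
def lipNorm (lam : Lattice d → ℝ) (f : Lattice d → ℂ) : ℝ≥0∞ :=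
  ⨆ (m : Lattice d) (j : Lattice d) (_ : j ≠ 0),
    ‖(f (m + j) - f m) / ((lam j - lam 0 : ℝ) : ℂ)‖ₑ

/-- The norm of the translation invariant Banach algebra of sequences. -/
def seqNorm (lam : Lattice d → ℝ) (f : Lattice d → ℂ) : ℝ≥0∞ := supNorm f + lipNorm lam f

theorem le_supNorm (f : Lattice d → ℂ) (m : Lattice d) : ‖f m‖ₑ ≤ supNorm f :=
  le_iSup (fun m => ‖f m‖ₑ) m

theorem le_lipNorm (lam : Lattice d → ℝ) (f : Lattice d → ℂ) (m j : Lattice d) (hj : j ≠ 0) :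
    ‖(f (m + j) - f m) / ((lam j - lam 0 : ℝ) : ℂ)‖ₑ ≤ lipNorm lam f :=
  (le_iSup₂_of_le m j (le_iSup (fun _ : j ≠ 0 => _) hj))

theorem supNorm_le {f : Lattice d → ℂ} {C : ℝ≥0∞} (h : ∀ m, ‖f m‖ₑ ≤ C) : supNorm f ≤ C :=
  iSup_le h

theorem lipNorm_le {lam : Lattice d → ℝ} {f : Lattice d → ℂ} {C : ℝ≥0∞}
    (h : ∀ m j, j ≠ 0 → ‖(f (m + j) - f m) / ((lam j - lam 0 : ℝ) : ℂ)‖ₑ ≤ C) :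
    lipNorm lam f ≤ C :=
  iSup_le fun m => iSup_le fun j => iSup_le (h m j)

theorem supNorm_le_seqNorm (lam : Lattice d → ℝ) (f : Lattice d → ℂ) :
    supNorm f ≤ seqNorm lam f := le_self_add

theorem seqNorm_add_le (lam : Lattice d → ℝ) (f g : Lattice d → ℂ) :
    seqNorm lam (f + g) ≤ seqNorm lam f + seqNorm lam g := by
  have h1 : supNorm (f + g) ≤ supNorm f + supNorm g := supNorm_le fun m =>
    (enorm_add_le _ _).trans (add_le_add (le_supNorm f m) (le_supNorm g m))
  have h2 : lipNorm lam (f + g) ≤ lipNorm lam f + lipNorm lam g := lipNorm_le fun m j hj => by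
    refine le_trans (le_of_eq_of_le ?_ (enorm_add_le _ _))
      (add_le_add (le_lipNorm lam f m j hj) (le_lipNorm lam g m j hj))
    congr 1
    simp only [Pi.add_apply]
    ring
  calc seqNorm lam (f + g) ≤ (supNorm f + supNorm g) + (lipNorm lam f + lipNorm lam g) :=
        add_le_add h1 h2
    _ = _ := by simp only [seqNorm]; ring

theorem seqNorm_const_mul (lam : Lattice d → ℝ) (z : ℂ) (f : Lattice d → ℂ) :
    seqNorm lam (fun m => z * f m) = ‖z‖ₑ * seqNorm lam f := by
  simp only [seqNorm, supNorm, lipNorm, mul_add, ENNReal.mul_iSup, ← enorm_mul, ← mul_sub,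
    mul_div_assoc]

/-- The discrete Leibniz rule bounds the difference quotients of a product; adding the product of
the two seminorms completes the factorization. -/
theorem seqNorm_mul_le (lam : Lattice d → ℝ) (f g : Lattice d → ℂ) :
    seqNorm lam (f * g) ≤ seqNorm lam f * seqNorm lam g := by
  have h1 : supNorm (f * g) ≤ supNorm f * supNorm g := supNorm_le fun m => by
    rw [Pi.mul_apply, enorm_mul]
    exact mul_le_mul' (le_supNorm f m) (le_supNorm g m)
  have h2 : lipNorm lam (f * g) ≤ supNorm f * lipNorm lam g + lipNorm lam f * supNorm g :=
    lipNorm_le fun m j hj => by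
      have : ((f * g) (m + j) - (f * g) m) / ((lam j - lam 0 : ℝ) : ℂ)
          = f (m + j) * ((g (m + j) - g m) / ((lam j - lam 0 : ℝ) : ℂ))
            + ((f (m + j) - f m) / ((lam j - lam 0 : ℝ) : ℂ)) * g m := by
        simp only [Pi.mul_apply]; ring
      rw [this]
      refine (enorm_add_le _ _).trans ?_
      rw [enorm_mul, enorm_mul]
      exact add_le_add (mul_le_mul' (le_supNorm f _) (le_lipNorm lam g m j hj))
        (mul_le_mul' (le_lipNorm lam f m j hj) (le_supNorm g m))
  calc seqNorm lam (f * g)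
      ≤ supNorm f * supNorm g + (supNorm f * lipNorm lam g + lipNorm lam f * supNorm g) :=
        add_le_add h1 h2
    _ ≤ supNorm f * supNorm g + (supNorm f * lipNorm lam g + lipNorm lam f * supNorm g)
          + lipNorm lam f * lipNorm lam g := le_self_add
    _ = _ := by simp only [seqNorm]; ring

theorem seqNorm_translate_le (lam : Lattice d → ℝ) (f : Lattice d → ℂ) (k : Lattice d) :
    seqNorm lam (fun m => f (m + k)) ≤ seqNorm lam f := by
  refine add_le_add (supNorm_le fun m => le_supNorm f _) (lipNorm_le fun m j hj => ?_)
  rw [add_right_comm]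
  exact le_lipNorm lam f (m + k) j hj

theorem seqNorm_le_tsum {ι : Type*} (lam : Lattice d → ℝ) (f : Lattice d → ℂ)
    (F : ι → Lattice d → ℂ) (h : ∀ m, HasSum (fun i => F i m) (f m)) :
    seqNorm lam f ≤ ∑' i, seqNorm lam (F i) := by
  have h1 : supNorm f ≤ ∑' i, supNorm (F i) := supNorm_le fun m =>
    (h m).enorm_le_of_bounded ENNReal.summable.hasSum fun i => le_supNorm (F i) m
  have h2 : lipNorm lam f ≤ ∑' i, lipNorm lam (F i) := lipNorm_le fun m j hj =>
    (((h (m + j)).sub (h m)).div_const _).enorm_le_of_bounded ENNReal.summable.hasSum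
      fun i => le_lipNorm lam (F i) m j hj
  calc seqNorm lam f ≤ _ := add_le_add h1 h2
    _ = _ := ENNReal.tsum_add.symm

/-! ### Weighted norms of matrices. -/

/-- The `k`-th diagonal of the matrix of `A`. -/
def diagonal (A : EllTwo d →L[ℂ] EllTwo d) (k : Lattice d) : Lattice d → ℂ :=
  fun m => entry A m (m + k)

/-- Matrix multiplication is a convolution of diagonals twisted by translations, which the norm does
not see. -/
theorem seqNorm_diagonal_mul_le (lam : Lattice d → ℝ) (A B : EllTwo d →L[ℂ] EllTwo d)
    (k : Lattice d) :
    seqNorm lam (diagonal (A * B) k)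
      ≤ ∑' l, seqNorm lam (diagonal A l) * seqNorm lam (diagonal B (k - l)) := by
  refine (seqNorm_le_tsum lam _ (fun l => diagonal A l * fun m => diagonal B (k - l) (m + l))
    fun m => ?_).trans (ENNReal.tsum_le_tsum fun l => (seqNorm_mul_le lam _ _).trans
      (mul_le_mul_right (seqNorm_translate_le lam _ l) _))
  have := ((Equiv.addLeft m).hasSum_iff).2 (entry_mul_hasSum A B m (m + k))
  refine this.congr_fun fun l => ?_
  simp [diagonal, add_assoc]

theorem oneNorm_add_le (k l : Lattice d) : oneNorm (k + l) ≤ oneNorm k + oneNorm l := by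
  rw [oneNorm, oneNorm, oneNorm, ← Finset.sum_add_distrib]
  exact Finset.sum_le_sum fun i _ => by
    rw [Pi.add_apply, Int.cast_add]; exact abs_add_le _ _

theorem oneNorm_nonneg (k : Lattice d) : 0 ≤ oneNorm k := Finset.sum_nonneg fun _ _ => abs_nonneg _

theorem oneNorm_zero : oneNorm (0 : Lattice d) = 0 := by simp [oneNorm]

theorem one_le_oneNorm {k : Lattice d} (hk : k ≠ 0) : 1 ≤ oneNorm k := by
  obtain ⟨i, hi⟩ := Function.ne_iff.1 hk
  refine le_trans ?_ (Finset.single_le_sum (f := fun i => |(k i : ℝ)|) (fun _ _ => abs_nonneg _)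
    (Finset.mem_univ i))
  have : (1 : ℤ) ≤ |k i| := Int.one_le_abs hi
  exact_mod_cast this

/-- The exponential weight `e^{s|k|}`. -/
def weight (s : ℝ) (k : Lattice d) : ℝ≥0∞ := ENNReal.ofReal (Real.exp (s * oneNorm k))

theorem weight_add (s t : ℝ) (k : Lattice d) : weight (s + t) k = weight s k * weight t k := by
  rw [weight, weight, weight, ← ENNReal.ofReal_mul (Real.exp_nonneg _), ← Real.exp_add, add_mul]

theorem weight_le_mul {s : ℝ} (hs : 0 ≤ s) (k l : Lattice d) :
    weight s k ≤ weight s l * weight s (k - l) := by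
  rw [weight, weight, weight, ← ENNReal.ofReal_mul (Real.exp_nonneg _), ← Real.exp_add, ← mul_add]
  refine ENNReal.ofReal_le_ofReal (Real.exp_le_exp.2 (mul_le_mul_of_nonneg_left ?_ hs))
  simpa using oneNorm_add_le l (k - l)

theorem weight_mono {s t : ℝ} (h : s ≤ t) (k : Lattice d) : weight s k ≤ weight t k :=
  ENNReal.ofReal_le_ofReal (Real.exp_le_exp.2 (mul_le_mul_of_nonneg_right h (oneNorm_nonneg k)))

theorem one_le_weight {s : ℝ} (hs : 0 ≤ s) (k : Lattice d) : 1 ≤ weight s k := by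
  refine le_of_eq_of_le ?_ (weight_mono hs k)
  simp [weight]

theorem shapeNorm_eq (lam : Lattice d → ℝ) (s : ℝ) (A : EllTwo d →L[ℂ] EllTwo d) :
    shapeNorm lam s A = ⨆ k, weight s k * seqNorm lam (diagonal A k) := rfl

theorem le_shapeNorm (lam : Lattice d → ℝ) (s : ℝ) (A : EllTwo d →L[ℂ] EllTwo d)
    (k : Lattice d) : weight s k * seqNorm lam (diagonal A k) ≤ shapeNorm lam s A :=
  le_iSup (fun k => weight s k * seqNorm lam (diagonal A k)) k

theorem shapeNorm_le {lam : Lattice d → ℝ} {s : ℝ} {A : EllTwo d →L[ℂ] EllTwo d} {C : ℝ≥0∞}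
    (h : ∀ k, weight s k * seqNorm lam (diagonal A k) ≤ C) : shapeNorm lam s A ≤ C := iSup_le h

/-- The weighted `ℓ¹` analogue of `shapeNorm`. -/
def sumNorm (lam : Lattice d → ℝ) (s : ℝ) (A : EllTwo d →L[ℂ] EllTwo d) : ℝ≥0∞ :=
  ∑' k, weight s k * seqNorm lam (diagonal A k)

theorem shapeNorm_add_le (lam : Lattice d → ℝ) (s : ℝ) (A B : EllTwo d →L[ℂ] EllTwo d) :
    shapeNorm lam s (A + B) ≤ shapeNorm lam s A + shapeNorm lam s B := shapeNorm_le fun k => by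
  have : diagonal (A + B) k = diagonal A k + diagonal B k := by
    funext m; exact entry_add A B _ _
  rw [this]
  calc _ ≤ weight s k * (seqNorm lam (diagonal A k) + seqNorm lam (diagonal B k)) :=
        mul_le_mul_right (seqNorm_add_le lam _ _) _
    _ = _ := mul_add _ _ _
    _ ≤ _ := add_le_add (le_shapeNorm lam s A k) (le_shapeNorm lam s B k)

theorem shapeNorm_smul (lam : Lattice d → ℝ) (s : ℝ) (z : ℂ) (A : EllTwo d →L[ℂ] EllTwo d) :
    shapeNorm lam s (z • A) = ‖z‖ₑ * shapeNorm lam s A := by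
  rw [shapeNorm_eq, shapeNorm_eq, ENNReal.mul_iSup]
  refine iSup_congr fun k => ?_
  have : diagonal (z • A) k = fun m => z * diagonal A k m := by
    funext m; exact entry_smul z A _ _
  rw [this, seqNorm_const_mul, mul_left_comm]

theorem shapeNorm_sub_le (lam : Lattice d → ℝ) (s : ℝ) (A B : EllTwo d →L[ℂ] EllTwo d) :
    shapeNorm lam s (A - B) ≤ shapeNorm lam s A + shapeNorm lam s B := by
  have h := shapeNorm_add_le lam s A ((-1 : ℂ) • B)
  rw [shapeNorm_smul] at h
  simpa [sub_eq_add_neg] using h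

theorem shapeNorm_mono {s t : ℝ} (h : s ≤ t) (lam : Lattice d → ℝ)
    (A : EllTwo d →L[ℂ] EllTwo d) : shapeNorm lam s A ≤ shapeNorm lam t A := shapeNorm_le fun k =>
  (mul_le_mul_left (weight_mono h k) _).trans (le_shapeNorm lam t A k)

theorem sumNorm_mono {s t : ℝ} (h : s ≤ t) (lam : Lattice d → ℝ)
    (A : EllTwo d →L[ℂ] EllTwo d) : sumNorm lam s A ≤ sumNorm lam t A :=
  ENNReal.tsum_le_tsum fun k => mul_le_mul_left (weight_mono h k) _

theorem weight_mul_seqNorm_mul_le {s : ℝ} (hs : 0 ≤ s) (lam : Lattice d → ℝ)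
    (A B : EllTwo d →L[ℂ] EllTwo d) (k : Lattice d) :
    weight s k * seqNorm lam (diagonal (A * B) k) ≤
      ∑' l, (weight s l * seqNorm lam (diagonal A l)) *
        (weight s (k - l) * seqNorm lam (diagonal B (k - l))) := by
  refine (mul_le_mul_right (seqNorm_diagonal_mul_le lam A B k) _).trans ?_
  rw [← ENNReal.tsum_mul_left]
  refine ENNReal.tsum_le_tsum fun l => ?_
  refine (mul_le_mul_left (weight_le_mul hs k l) _).trans (le_of_eq ?_)
  ring

/-- Young's inequality for the convolution of an ℓ¹ and an ℓ^∞ family of diagonals. Only one factor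
has to be summable, so a product costs at most one loss of weight. -/
theorem shapeNorm_mul_le {s : ℝ} (hs : 0 ≤ s) (lam : Lattice d → ℝ)
    (A B : EllTwo d →L[ℂ] EllTwo d) :
    shapeNorm lam s (A * B) ≤ sumNorm lam s A * shapeNorm lam s B := shapeNorm_le fun k => by
  refine (weight_mul_seqNorm_mul_le hs lam A B k).trans ?_
  rw [sumNorm, ← ENNReal.tsum_mul_right]
  exact ENNReal.tsum_le_tsum fun l => mul_le_mul_right (le_shapeNorm lam s B _) _

theorem shapeNorm_mul_le' {s : ℝ} (hs : 0 ≤ s) (lam : Lattice d → ℝ)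
    (A B : EllTwo d →L[ℂ] EllTwo d) :
    shapeNorm lam s (A * B) ≤ shapeNorm lam s A * sumNorm lam s B := shapeNorm_le fun k => by
  refine (weight_mul_seqNorm_mul_le hs lam A B k).trans ?_
  rw [sumNorm, ← ENNReal.tsum_mul_left, ← (Equiv.subLeft k).tsum_eq]
  refine ENNReal.tsum_le_tsum fun l => ?_
  simpa using mul_le_mul_left (le_shapeNorm lam s A (k - l)) _

theorem exists_ofDiagonals_enorm (w : Lattice d → Lattice d → ℂ)
    (h : ∑' k, supNorm (w k) ≠ ⊤) :
    ∃ A : EllTwo d →L[ℂ] EllTwo d, (∀ k, diagonal A k = w k) ∧ ‖A‖ₑ ≤ ∑' k, supNorm (w k) := by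
  have hk : ∀ k, supNorm (w k) ≠ ⊤ := fun k => ENNReal.ne_top_of_tsum_ne_top h k
  obtain ⟨A, hA, hAn⟩ := exists_ofDiagonals w (fun k => (supNorm (w k)).toReal)
    (ENNReal.summable_toReal h) fun k m => by
      have := ENNReal.toReal_mono (hk k) (le_supNorm (w k) m)
      rwa [toReal_enorm] at this
  refine ⟨A, fun k => funext (hA k), ?_⟩
  rw [← ENNReal.tsum_toReal_eq hk] at hAn
  rw [← ofReal_norm, ← ENNReal.ofReal_toReal h]
  exact ENNReal.ofReal_le_ofReal hAn

theorem ext_diagonal {A B : EllTwo d →L[ℂ] EllTwo d} (h : ∀ k, diagonal A k = diagonal B k) :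
    A = B := ext_entry fun m n => by
  simpa [diagonal] using congrFun (h (n - m)) m

theorem enorm_le_sumNorm {s : ℝ} (hs : 0 ≤ s) (lam : Lattice d → ℝ)
    (A : EllTwo d →L[ℂ] EllTwo d) : ‖A‖ₑ ≤ sumNorm lam s A := by
  have le : ∑' k, supNorm (diagonal A k) ≤ sumNorm lam s A :=
    ENNReal.tsum_le_tsum fun k => (supNorm_le_seqNorm lam _).trans
      (le_mul_of_one_le_left' (one_le_weight hs k))
  by_cases h : ∑' k, supNorm (diagonal A k) = ⊤
  · rw [h, top_le_iff] at le
    simp [le]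
  · obtain ⟨B, hB, hBn⟩ := exists_ofDiagonals_enorm (diagonal A) h
    rw [ext_diagonal hB] at hBn
    exact hBn.trans le

theorem continuous_enorm_entry (m n : Lattice d) :
    Continuous fun A : EllTwo d →L[ℂ] EllTwo d => ‖entry A m n‖ₑ :=
  continuous_enorm.comp (continuous_entry m n)

/-- The norm is a supremum built from continuous functions of the entries. Bounds thus pass to
operator-norm limits, and completeness of the space of matrices with finite `shapeNorm` is never
needed. -/
theorem lowerSemicontinuous_shapeNorm (lam : Lattice d → ℝ) (s : ℝ) :
    LowerSemicontinuous fun A : EllTwo d →L[ℂ] EllTwo d => shapeNorm lam s A := by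
  refine lowerSemicontinuous_iSup fun k => ?_
  refine (ENNReal.continuous_const_mul ENNReal.ofReal_ne_top).comp_lowerSemicontinuous ?_
    fun a b hab => mul_le_mul_right hab _
  refine LowerSemicontinuous.add (lowerSemicontinuous_iSup fun m =>
    (continuous_enorm_entry _ _).lowerSemicontinuous) ?_
  refine lowerSemicontinuous_iSup fun m => lowerSemicontinuous_iSup fun j =>
    lowerSemicontinuous_iSup fun _ => Continuous.lowerSemicontinuous ?_
  exact continuous_enorm.comp (((continuous_entry _ _).sub (continuous_entry _ _)).div_const _)

theorem shapeNorm_le_of_tendsto {lam : Lattice d → ℝ} {s : ℝ} {A : ℕ → EllTwo d →L[ℂ] EllTwo d}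
    {B : EllTwo d →L[ℂ] EllTwo d} {C : ℝ≥0∞} (h : Tendsto A atTop (𝓝 B))
    (hC : ∀ n, shapeNorm lam s (A n) ≤ C) : shapeNorm lam s B ≤ C :=
  ((lowerSemicontinuous_shapeNorm lam s).isClosed_preimage C).mem_of_tendsto h
    (Eventually.of_forall hC)

theorem seqNorm_zero (lam : Lattice d → ℝ) : seqNorm lam (0 : Lattice d → ℂ) = 0 := by
  simp [seqNorm, supNorm, lipNorm]

theorem IsDiagonal.diagonal_eq_zero {A : EllTwo d →L[ℂ] EllTwo d} (h : IsDiagonal A)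
    {k : Lattice d} (hk : k ≠ 0) : diagonal A k = 0 := by
  funext m
  exact h m (m + k) (by simpa using hk)

theorem IsDiagonal.sumNorm_eq {A : EllTwo d →L[ℂ] EllTwo d} (h : IsDiagonal A)
    (lam : Lattice d → ℝ) (s : ℝ) : sumNorm lam s A = seqNorm lam (diagonal A 0) := by
  rw [sumNorm, tsum_eq_single 0 fun k hk => by rw [h.diagonal_eq_zero hk, seqNorm_zero, mul_zero]]
  simp [weight, oneNorm_zero]

theorem shapeNorm_one_le (lam : Lattice d → ℝ) (s : ℝ) :
    shapeNorm lam s (1 : EllTwo d →L[ℂ] EllTwo d) ≤ 1 := shapeNorm_le fun k => by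
  by_cases hk : k = 0
  · subst hk
    have : diagonal (1 : EllTwo d →L[ℂ] EllTwo d) 0 = fun _ => 1 := by
      funext m; simp [diagonal, entry_one]
    simp [this, weight, oneNorm_zero, seqNorm, supNorm, lipNorm]
  · have : IsDiagonal (1 : EllTwo d →L[ℂ] EllTwo d) := fun m n h => by simp [entry_one, h]
    simp [this.diagonal_eq_zero hk, seqNorm_zero]

/-! ### Exponential sums and the loss of weight. -/

/-- The exponential sum `∑ e^{-δ|n|}` over the integers. -/
theorem tsum_int_exp_le {δ : ℝ} (h0 : 0 < δ) (h1 : δ ≤ 1) :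
    ∑' n : ℤ, ENNReal.ofReal (Real.exp (-δ * |(n : ℝ)|)) ≤ ENNReal.ofReal (3 / δ) := by
  set r := Real.exp (-δ) with hr
  have r0 : 0 < r := Real.exp_pos _
  have r1 : r < 1 := Real.exp_lt_one_iff.2 (by linarith)
  have g := hasSum_geometric_of_lt_one r0.le r1
  have hs : HasSum (fun n : ℤ => Real.exp (-δ * |(n : ℝ)|)) ((1 - r)⁻¹ + r * (1 - r)⁻¹) := by
    refine HasSum.of_nat_of_neg_add_one (g.congr_fun fun n => ?_)
      ((g.mul_left r).congr_fun fun n => ?_)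
    · rw [hr, ← Real.exp_nat_mul]; simp [mul_comm]
    · rw [hr, ← Real.exp_nat_mul, ← Real.exp_add, Int.cast_neg, abs_neg, abs_of_nonneg (by positivity)]
      push_cast; ring_nf
  rw [← ENNReal.ofReal_tsum_of_nonneg (fun _ => Real.exp_nonneg _) hs.summable, hs.tsum_eq]
  refine ENNReal.ofReal_le_ofReal ?_
  -- With `r ≤ 1 / (1 + δ)` the sum `(1 + r) / (1 - r)` is at most `(2 + δ) / δ`, and `δ ≤ 1`.
  have hr' : r * (1 + δ) ≤ 1 := by
    have : 1 + δ ≤ Real.exp δ := by linarith [Real.add_one_le_exp δ]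
    calc r * (1 + δ) ≤ r * Real.exp δ := by gcongr
      _ = 1 := by rw [hr, ← Real.exp_add]; simp
  rw [← one_add_mul, ← div_eq_mul_inv, div_le_div_iff₀ (by linarith) h0]
  nlinarith

theorem tsum_pi_prod (d : ℕ) (f : ℤ → ℝ≥0∞) :
    ∑' k : Lattice d, ∏ i, f (k i) = (∑' n, f n) ^ d := by
  induction d with
  | zero => simp [tsum_fintype]
  | succ d ih =>
    rw [← (Fin.consEquiv fun _ : Fin (d + 1) => ℤ).tsum_eq, ENNReal.tsum_prod', pow_succ', ← ih,
      ← ENNReal.tsum_mul_right]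
    refine tsum_congr fun n => ?_
    rw [← ENNReal.tsum_mul_left]
    refine tsum_congr fun k => ?_
    simp [Fin.consEquiv, Fin.prod_univ_succ]

theorem tsum_weight_le {δ : ℝ} (h0 : 0 < δ) (h1 : δ ≤ 1) :
    ∑' k : Lattice d, weight (-δ) k ≤ ENNReal.ofReal ((3 / δ) ^ d) := by
  have : ∀ k : Lattice d, weight (-δ) k
      = ∏ i, ENNReal.ofReal (Real.exp (-δ * |(k i : ℝ)|)) := fun k => by
    rw [weight, oneNorm, Finset.mul_sum, Real.exp_sum,
      ENNReal.ofReal_prod_of_nonneg fun _ _ => Real.exp_nonneg _]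
  simp_rw [this]
  rw [tsum_pi_prod d fun n => ENNReal.ofReal (Real.exp (-δ * |(n : ℝ)|)),
    ENNReal.ofReal_pow (by positivity)]
  exact pow_le_pow_left' (tsum_int_exp_le h0 h1) d

theorem sumNorm_le_shapeNorm {s δ : ℝ} (h0 : 0 < δ) (h1 : δ ≤ 1) (lam : Lattice d → ℝ)
    (A : EllTwo d →L[ℂ] EllTwo d) :
    sumNorm lam (s - δ) A ≤ ENNReal.ofReal ((3 / δ) ^ d) * shapeNorm lam s A := by
  refine le_trans ?_ (mul_le_mul_left (tsum_weight_le h0 h1) _)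
  rw [sumNorm, ← ENNReal.tsum_mul_right]
  refine ENNReal.tsum_le_tsum fun k => ?_
  rw [sub_eq_neg_add, weight_add, mul_assoc]
  exact mul_le_mul_right (le_shapeNorm lam s A k) _

/-! ### Small divisors of the perturbed eigenvalues. -/

/-- The Diophantine conditions on the sequence `lam`. -/
structure IsDiophantine (lam : Lattice d → ℝ) (c γ : ℝ) : Prop where
  injective : Function.Injective lam
  one_le : 1 ≤ c
  pos : 0 < γ
  le_rpow : ∀ k : Lattice d, k ≠ 0 → ∀ n : Lattice d,
    1 / |lam (n + k) - lam n| ≤ c * oneNorm k ^ γ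
  le_inv : ∀ k : Lattice d, k ≠ 0 → ∀ n : Lattice d,
    1 / |lam (n + k) - lam n| ≤ c * (1 + 1 / |lam k - lam 0|)
  diff_le : ∀ k : Lattice d, k ≠ 0 → ∀ n j : Lattice d, j ≠ 0 →
    |1 / (lam j - lam 0) *
        (1 / (lam (n + j + k) - lam (n + j)) - 1 / (lam (n + k) - lam n))|
      ≤ c * (1 + 1 / |lam k - lam 0|)

theorem IsDiophantine.abs_sub_pos {lam : Lattice d → ℝ} {c γ : ℝ} (h : IsDiophantine lam c γ)
    {k : Lattice d} (hk : k ≠ 0) (n : Lattice d) : 0 < |lam (n + k) - lam n| := by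
  rw [abs_pos, sub_ne_zero]
  exact fun h' => hk (by simpa using h.injective h')

theorem exists_bounds_of_seqNorm_le {lam : Lattice d → ℝ} (hlam : Function.Injective lam)
    {a : Lattice d → ℂ} {r : ℝ} (hr : 0 ≤ r) (ha : seqNorm lam a ≤ ENNReal.ofReal r) :
    ∃ S D : ℝ, S + D ≤ r ∧ 0 ≤ D ∧ (∀ m, ‖a m‖ ≤ S) ∧
      ∀ m j, ‖a (m + j) - a m‖ ≤ D * |lam j - lam 0| := by
  have ht : seqNorm lam a ≠ ⊤ := ne_top_of_le_ne_top ENNReal.ofReal_ne_top ha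
  obtain ⟨h1, h2⟩ := ENNReal.add_ne_top.1 ht
  refine ⟨(supNorm a).toReal, (lipNorm lam a).toReal, ?_, ENNReal.toReal_nonneg, fun m => ?_,
    fun m j => ?_⟩
  · rw [← ENNReal.toReal_add h1 h2]
    exact ENNReal.toReal_le_of_le_ofReal hr ha
  · simpa using ENNReal.toReal_mono h1 (le_supNorm a m)
  · by_cases hj : j = 0
    · simp [hj]
    · have := ENNReal.toReal_mono h2 (le_lipNorm lam a m j hj)
      have hp : 0 < |lam j - lam 0| := by
        rw [abs_pos, sub_ne_zero]; exact fun h' => hj (hlam h')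
      rwa [toReal_enorm, norm_div, Complex.norm_real, Real.norm_eq_abs, div_le_iff₀ hp] at this

theorem seqNorm_le_ofReal {lam : Lattice d → ℝ} (hlam : Function.Injective lam)
    {f : Lattice d → ℂ} {S D : ℝ} (hS : 0 ≤ S) (hD : 0 ≤ D) (h1 : ∀ m, ‖f m‖ ≤ S)
    (h2 : ∀ m j, j ≠ 0 → ‖f (m + j) - f m‖ ≤ D * |lam j - lam 0|) :
    seqNorm lam f ≤ ENNReal.ofReal (S + D) := by
  rw [ENNReal.ofReal_add hS hD]
  refine add_le_add (supNorm_le fun m => ?_) (lipNorm_le fun m j hj => ?_)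
  · rw [← ofReal_norm]; exact ENNReal.ofReal_le_ofReal (h1 m)
  · have hp : 0 < |lam j - lam 0| := by
      rw [abs_pos, sub_ne_zero]; exact fun h' => hj (hlam h')
    rw [← ofReal_norm]
    refine ENNReal.ofReal_le_ofReal ?_
    rw [norm_div, Complex.norm_real, Real.norm_eq_abs, div_le_iff₀ hp]
    exact h2 m j hj

/-- Differences of the perturbed eigenvalues are at least half those of the unperturbed ones. -/
theorem IsDiophantine.abs_sub_le {lam : Lattice d → ℝ} {c γ : ℝ} (h : IsDiophantine lam c γ)
    {a : Lattice d → ℂ} (ha : seqNorm lam a ≤ ENNReal.ofReal (1 / (4 * c)))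
    {k : Lattice d} (hk : k ≠ 0) (n : Lattice d) :
    |lam (n + k) - lam n| ≤ 2 * ‖(lam (n + k) + a (n + k)) - (lam n + a n)‖ := by
  have hc : 0 < c := by linarith [h.one_le]
  obtain ⟨S, D, hSD, hD, hS, hL⟩ := exists_bounds_of_seqNorm_le h.injective (by positivity) ha
  have hl : 0 < |lam k - lam 0| := by simpa using h.abs_sub_pos hk 0
  have hH := h.abs_sub_pos hk n
  set H := |lam (n + k) - lam n|
  set l := |lam k - lam 0|
  have e1 : ‖a (n + k) - a n‖ ≤ 2 * S := by
    have := norm_sub_le (a (n + k)) (a n)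
    linarith [hS (n + k), hS n]
  have e2 := hL n k
  -- The second Diophantine condition splits `1 / H` into a bounded part, paired with the supremum
  -- bound `2 * S`, and a part `1 / l`, paired with the Lipschitz bound `D * l`.
  have e3 : ‖a (n + k) - a n‖ / H ≤ 1 / 2 := by
    calc ‖a (n + k) - a n‖ / H = ‖a (n + k) - a n‖ * (1 / H) := by ring
      _ ≤ ‖a (n + k) - a n‖ * (c * (1 + 1 / l)) := by gcongr; exact h.le_inv k hk n
      _ = c * (‖a (n + k) - a n‖ + ‖a (n + k) - a n‖ / l) := by ring
      _ ≤ c * (2 * S + D) := by gcongr; rwa [div_le_iff₀ hl]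
      _ ≤ c * (2 * (1 / (4 * c))) := by gcongr; linarith
      _ = 1 / 2 := by field_simp; norm_num
  rw [div_le_iff₀ hH] at e3
  have e4 : H ≤ ‖(lam (n + k) + a (n + k)) - (lam n + a n)‖ + ‖a (n + k) - a n‖ := by
    have : H = ‖((lam (n + k) + a (n + k)) - (lam n + a n)) - (a (n + k) - a n)‖ := by
      have e5 : ((lam (n + k) + a (n + k)) - (lam n + a n)) - (a (n + k) - a n)
          = ((lam (n + k) - lam n : ℝ) : ℂ) := by push_cast; ring
      rw [e5, Complex.norm_real, Real.norm_eq_abs]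
    rw [this]; exact norm_sub_le _ _
  linarith

theorem IsDiophantine.inv_norm_sub_le {lam : Lattice d → ℝ} {c γ : ℝ} (h : IsDiophantine lam c γ)
    {a : Lattice d → ℂ} (ha : seqNorm lam a ≤ ENNReal.ofReal (1 / (4 * c)))
    {k : Lattice d} (hk : k ≠ 0) (n : Lattice d) :
    1 / ‖(lam (n + k) + a (n + k)) - (lam n + a n)‖ ≤ 2 * c * oneNorm k ^ γ := by
  have h1 := h.abs_sub_le ha hk n
  have h2 := h.abs_sub_pos hk n
  have h3 := h.le_rpow k hk n
  calc 1 / ‖(lam (n + k) + a (n + k)) - (lam n + a n)‖ ≤ 1 / (|lam (n + k) - lam n| / 2) := by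
        gcongr; linarith
    _ = 2 * (1 / |lam (n + k) - lam n|) := by ring
    _ ≤ 2 * (c * oneNorm k ^ γ) := by gcongr
    _ = _ := by ring

/-- The small divisor estimate for the perturbed eigenvalues. -/
theorem IsDiophantine.seqNorm_inv_le {lam : Lattice d → ℝ} {c γ : ℝ} (h : IsDiophantine lam c γ)
    {a : Lattice d → ℂ} (ha : seqNorm lam a ≤ ENNReal.ofReal (1 / (4 * c)))
    {k : Lattice d} (hk : k ≠ 0) :
    seqNorm lam (fun m => 1 / ((lam (m + k) + a (m + k)) - (lam m + a m)))
      ≤ ENNReal.ofReal (12 * c ^ 2 * oneNorm k ^ (2 * γ)) := by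
  have hc1 := h.one_le
  have hc : 0 < c := by linarith
  obtain ⟨S, D, hSD, hD, hS, hL⟩ := exists_bounds_of_seqNorm_le h.injective (by positivity) ha
  have hS0 : 0 ≤ S := (norm_nonneg _).trans (hS 0)
  have ht1 : 1 ≤ oneNorm k ^ γ := Real.one_le_rpow (one_le_oneNorm hk) h.pos.le
  have htt : oneNorm k ^ (2 * γ) = (oneNorm k ^ γ) ^ 2 := by
    rw [mul_comm, Real.rpow_mul (oneNorm_nonneg k)]; norm_cast
  have hl1 : 1 / |lam k - lam 0| ≤ c * oneNorm k ^ γ := by simpa using h.le_rpow k hk 0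
  rw [htt]
  set t := oneNorm k ^ γ
  set w : Lattice d → ℂ := fun m => (lam (m + k) + a (m + k)) - (lam m + a m) with hw
  have hwn : ∀ m, 1 / ‖w m‖ ≤ 2 * c * t := fun m => h.inv_norm_sub_le ha hk m
  have hw2 : ∀ m, |lam (m + k) - lam m| ≤ 2 * ‖w m‖ := fun m => h.abs_sub_le ha hk m
  have hw0 : ∀ m, 0 < ‖w m‖ := fun m => by linarith [hw2 m, h.abs_sub_pos hk m]
  -- The three terms are the supremum, the difference quotient of the unperturbed reciprocals (third
  -- Diophantine condition, with a factor 4 from doubling both gaps), and the contribution of `a`.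
  -- After `D ≤ 1 / (4 * c)` their coefficients 2, 4 + 4 and 2 add up to 12.
  have key : seqNorm lam (fun m => 1 / w m)
      ≤ ENNReal.ofReal (2 * c * t + (4 * (c * (1 + c * t)) + 2 * D * (2 * c * t) ^ 2)) := by
    refine seqNorm_le_ofReal h.injective (by positivity) (by positivity) (fun m => ?_)
      fun m j hj => ?_
    · rw [norm_div, norm_one]; exact hwn m
    · have hlj : 0 < |lam j - lam 0| := by simpa using h.abs_sub_pos hj 0
      set lj := |lam j - lam 0| with hljdef
      have n1 : w m ≠ 0 := norm_pos_iff.1 (hw0 m)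
      have n2 : w (m + j) ≠ 0 := norm_pos_iff.1 (hw0 (m + j))
      have i1 : ‖w m - w (m + j)‖ ≤ |(lam (m + k) - lam m) - (lam (m + j + k) - lam (m + j))|
          + 2 * D * lj := by
        have : w m - w (m + j)
            = (((lam (m + k) - lam m) - (lam (m + j + k) - lam (m + j)) : ℝ) : ℂ)
              + ((a (m + j) - a m) - (a (m + k + j) - a (m + k))) := by
          simp only [hw, add_right_comm m k j]; push_cast; ring
        rw [this]
        refine (norm_add_le _ _).trans ?_
        rw [Complex.norm_real, Real.norm_eq_abs]
        have := norm_sub_le (a (m + j) - a m) (a (m + k + j) - a (m + k))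
        linarith [hL m j, hL (m + k) j]
      have i2 : |(lam (m + k) - lam m) - (lam (m + j + k) - lam (m + j))|
          / (‖w m‖ * ‖w (m + j)‖) ≤ 4 * (c * (1 + c * t)) * lj := by
        have p1 := h.abs_sub_pos hk m
        have p2 := h.abs_sub_pos hk (m + j)
        have h3 := (h.diff_le k hk m j hj).trans
          (mul_le_mul_of_nonneg_left (add_le_add_right hl1 1) hc.le)
        have q1 : lam (m + k) - lam m ≠ 0 := abs_pos.1 p1
        have q2 : lam (m + j + k) - lam (m + j) ≠ 0 := abs_pos.1 p2
        have e : 1 / (lam j - lam 0) *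
            (1 / (lam (m + j + k) - lam (m + j)) - 1 / (lam (m + k) - lam m))
            = ((lam (m + k) - lam m) - (lam (m + j + k) - lam (m + j)))
              / ((lam j - lam 0) * ((lam (m + k) - lam m) * (lam (m + j + k) - lam (m + j)))) := by
          have q3 : lam j - lam 0 ≠ 0 := abs_pos.1 hlj
          field_simp
        rw [e, abs_div, abs_mul, abs_mul, div_le_iff₀ (by positivity)] at h3
        rw [div_le_iff₀ (mul_pos (hw0 _) (hw0 _))]
        refine h3.trans ?_
        have := mul_le_mul (hw2 m) (hw2 (m + j)) (abs_nonneg _) (by positivity)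
        calc _ ≤ c * (1 + c * t) * (lj * (2 * ‖w m‖ * (2 * ‖w (m + j)‖))) := by gcongr
          _ = _ := by ring
      have i3 : 2 * D * lj / (‖w m‖ * ‖w (m + j)‖) ≤ 2 * D * (2 * c * t) ^ 2 * lj := by
        calc _ = 2 * D * lj * (1 / ‖w m‖ * (1 / ‖w (m + j)‖)) := by ring
          _ ≤ 2 * D * lj * ((2 * c * t) * (2 * c * t)) := by
            have := hwn m
            have := hwn (m + j)
            gcongr
          _ = _ := by ring
      rw [div_sub_div _ _ n2 n1, one_mul, mul_one, norm_div, norm_mul, mul_comm ‖w (m + j)‖]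
      calc _ ≤ (|(lam (m + k) - lam m) - (lam (m + j + k) - lam (m + j))| + 2 * D * lj)
            / (‖w m‖ * ‖w (m + j)‖) := by gcongr
        _ ≤ _ := by rw [add_div, add_mul]; exact add_le_add i2 i3
  refine key.trans (ENNReal.ofReal_le_ofReal ?_)
  have e1 : 2 * D * (2 * c * t) ^ 2 ≤ 2 * (1 / (4 * c)) * (2 * c * t) ^ 2 := by
    gcongr; linarith
  have e2 : 2 * (1 / (4 * c)) * (2 * c * t) ^ 2 = 2 * c * t ^ 2 := by field_simp; ring
  have e3 : t ≤ t ^ 2 := by nlinarith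
  have e4 : c ≤ c ^ 2 := by nlinarith
  have e5 : c * t ≤ c ^ 2 * t ^ 2 := by gcongr
  have e6 : c ≤ c ^ 2 * t ^ 2 := by nlinarith
  have e7 : c * t ^ 2 ≤ c ^ 2 * t ^ 2 := by gcongr
  have e8 : c ^ 2 * t ≤ c ^ 2 * t ^ 2 := by gcongr
  nlinarith

/-- The left side is maximal at `t = x / δ`; the bound is `y ≤ exp (y - 1)` at `y = t * δ / x`,
raised to the power `x`. For `x = 2 * γ` this produces `gConst`. -/
theorem rpow_mul_exp_le {x δ t : ℝ} (hx : 0 < x) (hδ : 0 < δ) (ht : 0 ≤ t) :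
    t ^ x * Real.exp (-δ * t) ≤ (x / Real.exp 1) ^ x * δ ^ (-x) := by
  have h1 : t * δ / x ≤ Real.exp (t * δ / x - 1) := by
    linarith [Real.add_one_le_exp (t * δ / x - 1)]
  have h2 := Real.rpow_le_rpow (by positivity) h1 hx.le
  rw [← Real.exp_mul, Real.div_rpow (by positivity) hx.le, Real.mul_rpow ht hδ.le] at h2
  have h3 : Real.exp ((t * δ / x - 1) * x) = Real.exp (t * δ) * Real.exp (-x) := by
    rw [← Real.exp_add]; congr 1; field_simp; ring
  rw [h3, div_le_iff₀ (by positivity)] at h2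
  rw [Real.div_rpow hx.le (Real.exp_nonneg _), ← Real.exp_mul, one_mul, Real.rpow_neg hδ.le,
    ← div_eq_mul_inv, div_div, le_div_iff₀ (by positivity)]
  rw [Real.exp_neg] at h2
  have h4 : Real.exp (-δ * t) * Real.exp (t * δ) = 1 := by rw [← Real.exp_add]; simp [mul_comm]
  calc t ^ x * Real.exp (-δ * t) * (Real.exp x * δ ^ x)
      = (t ^ x * δ ^ x) * (Real.exp (-δ * t) * Real.exp x) := by ring
    _ ≤ (Real.exp (t * δ) * (Real.exp x)⁻¹ * x ^ x) * (Real.exp (-δ * t) * Real.exp x) := by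
        gcongr
    _ = (Real.exp (-δ * t) * Real.exp (t * δ)) * ((Real.exp x)⁻¹ * Real.exp x) * x ^ x := by ring
    _ = x ^ x := by rw [h4, inv_mul_cancel₀ (Real.exp_pos x).ne']; ring

theorem gConst_pos {γ : ℝ} (hγ : 0 < γ) : 0 < gConst γ := by
  unfold gConst; positivity

/-! ### The homological equation. -/

/-- The diagonals of the solution of the homological equation. -/
def homologicalDiagonal (lam : Lattice d → ℝ) (a : Lattice d → ℂ) (P : EllTwo d →L[ℂ] EllTwo d)
    (k : Lattice d) : Lattice d → ℂ :=
  if k = 0 then 0 else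
    diagonal P k * fun m => 1 / ((lam (m + k) + a (m + k)) - (lam m + a m))

theorem IsDiophantine.weight_mul_seqNorm_homologicalDiagonal_le {lam : Lattice d → ℝ} {c γ : ℝ}
    (h : IsDiophantine lam c γ)
    {a : Lattice d → ℂ} (ha : seqNorm lam a ≤ ENNReal.ofReal (1 / (4 * c)))
    (P : EllTwo d →L[ℂ] EllTwo d) (s : ℝ) {δ : ℝ} (hδ : 0 < δ) (k : Lattice d) :
    weight (s - δ) k * seqNorm lam (homologicalDiagonal lam a P k)
      ≤ ENNReal.ofReal (12 * c ^ 2 * gConst γ * δ ^ (-(2 * γ))) * shapeNorm lam s P := by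
  rw [homologicalDiagonal]
  split_ifs with hk
  · simp [seqNorm_zero]
  · have e1 : weight (-δ) k * ENNReal.ofReal (12 * c ^ 2 * oneNorm k ^ (2 * γ))
        ≤ ENNReal.ofReal (12 * c ^ 2 * gConst γ * δ ^ (-(2 * γ))) := by
      rw [weight, ← ENNReal.ofReal_mul (Real.exp_nonneg _)]
      refine ENNReal.ofReal_le_ofReal ?_
      have := rpow_mul_exp_le (x := 2 * γ) (by linarith [h.pos]) hδ (oneNorm_nonneg k)
      calc _ = 12 * c ^ 2 * (oneNorm k ^ (2 * γ) * Real.exp (-δ * oneNorm k)) := by ring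
        _ ≤ 12 * c ^ 2 * (gConst γ * δ ^ (-(2 * γ))) := mul_le_mul_of_nonneg_left this (by positivity)
        _ = _ := by ring
    calc _ ≤ weight (s - δ) k * (seqNorm lam (diagonal P k) *
            ENNReal.ofReal (12 * c ^ 2 * oneNorm k ^ (2 * γ))) :=
          mul_le_mul_right ((seqNorm_mul_le lam _ _).trans
            (mul_le_mul_right (h.seqNorm_inv_le ha hk) _)) _
      _ = (weight (-δ) k * ENNReal.ofReal (12 * c ^ 2 * oneNorm k ^ (2 * γ))) *
            (weight s k * seqNorm lam (diagonal P k)) := by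
          rw [sub_eq_neg_add, weight_add]; ring
      _ ≤ _ := mul_le_mul' e1 (le_shapeNorm lam s P k)

/-- Solution of the homological equation `[diag (lam + a), W] = diag P - P`. -/
theorem IsDiophantine.exists_homological {lam : Lattice d → ℝ} {c γ : ℝ}
    (h : IsDiophantine lam c γ)
    {a : Lattice d → ℂ} (ha : seqNorm lam a ≤ ENNReal.ofReal (1 / (4 * c)))
    (P : EllTwo d →L[ℂ] EllTwo d) {s δ p : ℝ} (hδ : 0 < δ) (hδ1 : δ ≤ 1) (hs : δ ≤ s)
    (hP : shapeNorm lam s P ≤ ENNReal.ofReal p) :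
    ∃ W : EllTwo d →L[ℂ] EllTwo d,
      (∀ m n, ((lam m + a m) - (lam n + a n)) * entry W m n
        = (if m = n then entry P m m else 0) - entry P m n) ∧
      shapeNorm lam (s - δ) W ≤ ENNReal.ofReal (12 * c ^ 2 * gConst γ * δ ^ (-(2 * γ)) * p) ∧
      sumNorm lam (s - δ) W ≤
        ENNReal.ofReal (12 * c ^ 2 * gConst γ * (δ / 2) ^ (-(2 * γ)) * (6 / δ) ^ d * p) := by
  have hg := gConst_pos h.pos
  have hw : ∀ t, 0 < t → ∀ k,
      weight (s - t) k * seqNorm lam (homologicalDiagonal lam a P k)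
        ≤ ENNReal.ofReal (12 * c ^ 2 * gConst γ * t ^ (-(2 * γ)) * p) := fun t ht k => by
    rw [ENNReal.ofReal_mul (by positivity)]
    exact (h.weight_mul_seqNorm_homologicalDiagonal_le ha P s ht k).trans (mul_le_mul_right hP _)
  -- The loss `δ` is split in two: one half absorbs the small divisors, the other makes the
  -- diagonals summable.
  have hsum : ∑' k, supNorm (homologicalDiagonal lam a P k) ≠ ⊤ := by
    refine ne_top_of_le_ne_top (b := ENNReal.ofReal ((3 / (δ / 2)) ^ d) *
      ENNReal.ofReal (12 * c ^ 2 * gConst γ * (δ / 2) ^ (-(2 * γ)) * p))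
      (ENNReal.mul_ne_top ENNReal.ofReal_ne_top ENNReal.ofReal_ne_top) ?_
    refine le_trans ?_ (mul_le_mul_left
      (tsum_weight_le (d := d) (half_pos hδ) (by linarith)) _)
    rw [← ENNReal.tsum_mul_right]
    refine ENNReal.tsum_le_tsum fun k => ?_
    calc supNorm (homologicalDiagonal lam a P k)
        ≤ weight (s - δ) k * seqNorm lam (homologicalDiagonal lam a P k) :=
          (supNorm_le_seqNorm lam _).trans (le_mul_of_one_le_left' (one_le_weight (by linarith) k))
      _ = weight (-(δ / 2)) k *
            (weight (s - δ / 2) k * seqNorm lam (homologicalDiagonal lam a P k)) := by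
          rw [← mul_assoc, ← weight_add]; congr 2; ring
      _ ≤ _ := mul_le_mul_right (hw _ (half_pos hδ) k) _
  obtain ⟨W, hW, -⟩ := exists_ofDiagonals_enorm (homologicalDiagonal lam a P) hsum
  have hshape : ∀ t, 0 < t →
      shapeNorm lam (s - t) W ≤ ENNReal.ofReal (12 * c ^ 2 * gConst γ * t ^ (-(2 * γ)) * p) :=
    fun t ht => shapeNorm_le fun k => by rw [hW]; exact hw t ht k
  refine ⟨W, fun m n => ?_, hshape δ hδ, ?_⟩
  · have e : entry W m n = homologicalDiagonal lam a P (n - m) m := by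
      rw [← hW]; simp [diagonal]
    rw [e, homologicalDiagonal]
    by_cases hmn : m = n
    · simp [hmn]
    · have hk : n - m ≠ 0 := sub_ne_zero.2 (Ne.symm hmn)
      have h0 : ((lam (m + (n - m)) + a (m + (n - m))) - (lam m + a m) : ℂ) ≠ 0 := by
        have := h.abs_sub_le ha hk m
        have := h.abs_sub_pos hk m
        rw [← norm_pos_iff]; linarith
      rw [add_sub_cancel] at h0
      simp only [hk, hmn, if_false, Pi.mul_apply, diagonal, add_sub_cancel]
      field_simp
      ring
  · have := sumNorm_le_shapeNorm (s := s - δ / 2) (half_pos hδ) (by linarith) lam W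
    rw [show s - δ / 2 - δ / 2 = s - δ by ring] at this
    refine this.trans ((mul_le_mul_right (hshape _ (half_pos hδ)) _).trans (le_of_eq ?_))
    rw [← ENNReal.ofReal_mul (by positivity)]
    congr 1
    rw [show 3 / (δ / 2) = 6 / δ by field_simp; norm_num]
    ring

/-! ### One step of the iteration. -/

theorem shapeNorm_zero (lam : Lattice d → ℝ) (s : ℝ) :
    shapeNorm lam s (0 : EllTwo d →L[ℂ] EllTwo d) = 0 := by
  rw [← zero_smul ℂ (0 : EllTwo d →L[ℂ] EllTwo d), shapeNorm_smul, enorm_zero, zero_mul]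

theorem seqNorm_diagonal_zero_le (lam : Lattice d → ℝ) (s : ℝ) (A : EllTwo d →L[ℂ] EllTwo d) :
    seqNorm lam (diagonal A 0) ≤ shapeNorm lam s A := by
  simpa [weight, oneNorm_zero] using le_shapeNorm lam s A 0

theorem IsDiagonal.shapeNorm_le {A : EllTwo d →L[ℂ] EllTwo d} (h : IsDiagonal A)
    (lam : Lattice d → ℝ) (s : ℝ) : shapeNorm lam s A ≤ seqNorm lam (diagonal A 0) := by
  refine PurePoint.shapeNorm_le fun k => ?_
  by_cases hk : k = 0
  · simp [hk, weight, oneNorm_zero]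
  · simp [h.diagonal_eq_zero hk, seqNorm_zero]

theorem exists_diagonalPart (lam : Lattice d → ℝ) {s p : ℝ} (hp : 0 ≤ p)
    (P : EllTwo d →L[ℂ] EllTwo d) (hP : shapeNorm lam s P ≤ ENNReal.ofReal p) :
    ∃ D : EllTwo d →L[ℂ] EllTwo d, IsDiagonal D ∧ (∀ m, entry D m m = entry P m m) ∧
      seqNorm lam (diagonal D 0) ≤ ENNReal.ofReal p ∧ ‖D‖ ≤ p := by
  have h0 := (seqNorm_diagonal_zero_le lam s P).trans hP
  obtain ⟨D, hD, hDn⟩ := exists_diagonal (fun m => entry P m m) p fun m => by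
    have := ((le_supNorm (diagonal P 0) m).trans (supNorm_le_seqNorm lam _)).trans h0
    rw [← ofReal_norm, ENNReal.ofReal_le_ofReal_iff hp] at this
    simpa [diagonal] using this
  have he := entry_of_apply hD
  refine ⟨D, fun m n hmn => by rw [he, if_neg hmn], fun m => by rw [he, if_pos rfl], ?_, hDn⟩
  have : diagonal D 0 = diagonal P 0 := by funext m; simp [diagonal, he]
  rwa [this]

/-- Inverts `1 + W` without loss of weight. Partial sums of the Neumann series applied to `Q`
satisfy `S (n + 1) = Q - W * S n`, which preserves the bound `2 * x` since `x + (1 / 2) * (2 * x) =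
2 * x`. -/
theorem exists_one_add_mul_eq (lam : Lattice d → ℝ) {s : ℝ} (hs : 0 ≤ s)
    (W Q : EllTwo d →L[ℂ] EllTwo d) {x : ℝ} (hx : 0 ≤ x)
    (hW : sumNorm lam s W ≤ ENNReal.ofReal (1 / 2)) (hQ : shapeNorm lam s Q ≤ ENNReal.ofReal x) :
    ∃ P : EllTwo d →L[ℂ] EllTwo d, (1 + W) * P = Q ∧
      shapeNorm lam s P ≤ ENNReal.ofReal (2 * x) := by
  have hWn : ‖-W‖ < 1 := by
    have := (enorm_le_sumNorm hs lam W).trans hW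
    rw [← ofReal_norm, ENNReal.ofReal_le_ofReal_iff (by norm_num)] at this
    rw [norm_neg]; linarith
  refine ⟨(∑' n, (-W) ^ n) * Q, ?_, ?_⟩
  · have := mul_neg_geom_series (-W) hWn
    rw [sub_neg_eq_add] at this
    rw [← mul_assoc, this, one_mul]
  · have hlim : Tendsto (fun n => (∑ i ∈ Finset.range n, (-W) ^ i) * Q) atTop
        (𝓝 ((∑' n, (-W) ^ n) * Q)) :=
      (summable_geometric_of_norm_lt_one hWn).hasSum.tendsto_sum_nat.mul_const Q
    refine shapeNorm_le_of_tendsto hlim fun n => ?_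
    induction n with
    | zero =>
      rw [Finset.range_zero, Finset.sum_empty, zero_mul, shapeNorm_zero]
      exact zero_le
    | succ n ih =>
      have : (∑ i ∈ Finset.range (n + 1), (-W) ^ i) * Q
          = Q - W * ((∑ i ∈ Finset.range n, (-W) ^ i) * Q) := by
        rw [Finset.sum_range_succ', ← mul_assoc, Finset.mul_sum, pow_zero, add_mul, one_mul,
          sub_eq_add_neg, add_comm, ← neg_mul, ← Finset.sum_neg_distrib]
        congr 3
        funext i
        rw [pow_succ', neg_mul]
      rw [this]
      calc _ ≤ ENNReal.ofReal x + ENNReal.ofReal (1 / 2) * ENNReal.ofReal (2 * x) :=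
            (shapeNorm_sub_le lam s _ _).trans (add_le_add hQ ((shapeNorm_mul_le hs lam _ _).trans
              (mul_le_mul' hW ih)))
        _ = _ := by
            rw [← ENNReal.ofReal_mul (by norm_num), ← ENNReal.ofReal_add hx (by positivity)]
            congr 1; ring

/-- One step of the iteration. -/
theorem IsDiophantine.exists_step {lam : Lattice d → ℝ} {c γ : ℝ} (h : IsDiophantine lam c γ)
    (D P : EllTwo d →L[ℂ] EllTwo d) (hD : IsDiagonal D)
    (hDn : shapeNorm lam 0 D ≤ ENNReal.ofReal (1 / (4 * c)))
    {s δ p : ℝ} (hδ : 0 < δ) (hδ1 : δ ≤ 1) (hs : δ ≤ s) (hp : 0 ≤ p)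
    (hP : shapeNorm lam s P ≤ ENNReal.ofReal p) {ω : ℝ}
    (hω : 12 * c ^ 2 * gConst γ * (δ / 2) ^ (-(2 * γ)) * (6 / δ) ^ d * p ≤ ω) (hω2 : ω ≤ 1 / 2) :
    ∃ W P' D' : EllTwo d →L[ℂ] EllTwo d, IsDiagonal D' ∧
      shapeNorm lam 0 D' ≤ ENNReal.ofReal p ∧ ‖D'‖ ≤ p ∧
      IsCommutator lam W (D' - P - D * W + W * D) ∧
      (1 + W) * P' = P * W - W * D' ∧
      sumNorm lam (s - δ) W ≤ ENNReal.ofReal ω ∧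
      shapeNorm lam (s - δ) P' ≤
        ENNReal.ofReal (4 * (12 * c ^ 2 * gConst γ) * (δ ^ (-(2 * γ)) * (3 / δ) ^ d) * p ^ 2) := by
  have hg := gConst_pos h.pos
  have hc := h.one_le
  have ha := (seqNorm_diagonal_zero_le lam 0 D).trans hDn
  obtain ⟨W, hW, hWs, hWω⟩ := h.exists_homological ha P hδ hδ1 hs hP
  obtain ⟨D', hD', hD'e, hD's, hD'n⟩ := exists_diagonalPart lam hp P hP
  have hWω' := hWω.trans (ENNReal.ofReal_le_ofReal hω)
  set y := 12 * c ^ 2 * gConst γ * δ ^ (-(2 * γ)) with hy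
  have hy0 : 0 ≤ y := by positivity
  have h3 : 1 ≤ (3 / δ) ^ d := one_le_pow₀ (by rw [le_div_iff₀ hδ]; linarith)
  -- Both products are quadratic in `p`. In the first, `P` is taken in the summed norm at the cost
  -- of `(3 / δ) ^ d`; in the second, `D'` is diagonal and needs no summation.
  have hQ : shapeNorm lam (s - δ) (P * W - W * D')
      ≤ ENNReal.ofReal (2 * ((3 / δ) ^ d * y * p ^ 2)) := by
    have e1 : shapeNorm lam (s - δ) (P * W) ≤ ENNReal.ofReal ((3 / δ) ^ d * y * p ^ 2) := by
      refine (shapeNorm_mul_le (by linarith) lam _ _).trans ((mul_le_mul'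
        ((sumNorm_le_shapeNorm hδ hδ1 lam P).trans (mul_le_mul_right hP _)) hWs).trans
        (le_of_eq ?_))
      rw [← ENNReal.ofReal_mul (by positivity), ← ENNReal.ofReal_mul (by positivity)]
      congr 1; ring
    have e2 : shapeNorm lam (s - δ) (W * D') ≤ ENNReal.ofReal ((3 / δ) ^ d * y * p ^ 2) := by
      refine (shapeNorm_mul_le' (by linarith) lam _ _).trans ((mul_le_mul' hWs
        ((hD'.sumNorm_eq lam _).le.trans hD's)).trans ?_)
      rw [← ENNReal.ofReal_mul (by positivity)]
      refine ENNReal.ofReal_le_ofReal ?_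
      calc y * p * p = 1 * y * p ^ 2 := by ring
        _ ≤ _ := by gcongr
    refine (shapeNorm_sub_le lam _ _ _).trans ((add_le_add e1 e2).trans (le_of_eq ?_))
    rw [← ENNReal.ofReal_add (by positivity) (by positivity)]
    congr 1; ring
  obtain ⟨P', hP', hP's⟩ := exists_one_add_mul_eq lam (by linarith) W _ (by positivity)
    (hWω'.trans (ENNReal.ofReal_le_ofReal hω2)) hQ
  refine ⟨W, P', D', hD', (hD'.shapeNorm_le lam 0).trans hD's, hD'n, fun m n => ?_, hP', hWω',
    hP's.trans (le_of_eq (by congr 1; rw [hy]; ring))⟩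
  have := hW m n
  simp only [diagonal, add_zero] at this
  rw [entry_add, entry_sub, entry_sub, hD.entry_mul, hD.mul_entry]
  have e : entry D' m n = if m = n then entry P m m else 0 := by
    split_ifs with hmn
    · rw [← hmn, hD'e]
    · exact hD' m n hmn
  rw [e, ← this]; ring

/-! ### The iteration and its bounds. -/

/-- The operators produced by the iteration. -/
structure IterationState (d : ℕ) where
  /-- The diagonal correction. -/
  D : EllTwo d →L[ℂ] EllTwo d
  /-- The remaining perturbation. -/
  P : EllTwo d →L[ℂ] EllTwo d
  /-- The conjugating operator. -/
  U : EllTwo d →L[ℂ] EllTwo d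

/-- The bounds valid after `j` steps of the iteration. -/
structure IterationState.Bounds (lam : Lattice d → ℝ) (V : EllTwo d →L[ℂ] EllTwo d)
    (α σ E K : ℝ) (j : ℕ) (S : IterationState d) : Prop where
  isDiagonal : IsDiagonal S.D
  -- The right side is the partial sum of `E * (1 / 8) ^ i` over `i < j`.
  shapeNorm_D : shapeNorm lam 0 S.D ≤ ENNReal.ofReal (8 / 7 * E * (1 - (1 / 8) ^ j))
  shapeNorm_P : shapeNorm lam (α - σ * (1 - (1 / 2) ^ j)) S.P
    ≤ ENNReal.ofReal (E * (1 / (4 * K)) ^ j)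
  -- Formally this says `(T + V) U = U (T + D + P)`.
  isCommutator : IsCommutator lam S.U (S.U * (S.D + S.P) - V * S.U)
  norm_sub_one : ‖S.U - 1‖ ≤ (1 - (1 / 4) ^ j) / 2
  shapeNorm_U : shapeNorm lam (α - σ) S.U ≤ ENNReal.ofReal (2 - (1 / 4) ^ j)

/-- The cost of step `j`, whose width is `σ * (1 / 2) ^ (j + 1)`; these widths sum to `σ`. The cost
grows like `K ^ j` with `K = 2 ^ (2 * γ + d)`. -/
theorem rpow_step {σ γ : ℝ} (hσ : 0 < σ) (d j : ℕ) :
    (σ * (1 / 2) ^ (j + 1)) ^ (-(2 * γ)) * (3 / (σ * (1 / 2) ^ (j + 1))) ^ d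
      = 3 ^ d * σ ^ (-(2 * γ + d)) * ((2 : ℝ) ^ (2 * γ + d)) ^ (j + 1) := by
  have e1 : ((1 / 2 : ℝ) ^ (j + 1)) = (2 : ℝ) ^ (-((j + 1 : ℕ) : ℝ)) := by
    rw [Real.rpow_neg (by norm_num), Real.rpow_natCast]; simp
  have hδ : 0 < σ * (1 / 2) ^ (j + 1) := by positivity
  have e2 : (3 / (σ * (1 / 2) ^ (j + 1))) ^ d
      = 3 ^ d * (σ * (1 / 2) ^ (j + 1)) ^ (-(d : ℝ)) := by
    rw [div_pow, Real.rpow_neg hδ.le, Real.rpow_natCast, div_eq_mul_inv]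
  have e3 : ((2 : ℝ) ^ (2 * γ + d)) ^ (j + 1) = (2 : ℝ) ^ ((2 * γ + d) * ((j + 1 : ℕ) : ℝ)) := by
    rw [Real.rpow_mul (by norm_num), Real.rpow_natCast]
  rw [e2, mul_left_comm, ← Real.rpow_add hδ, mul_assoc, e3, Real.mul_rpow hσ.le (by positivity),
    e1, ← Real.rpow_mul (by norm_num), ← neg_add, neg_mul_neg, mul_comm ((j + 1 : ℕ) : ℝ)]

theorem rpow_half_step {δ γ : ℝ} (hδ : 0 < δ) (d : ℕ) :
    (δ / 2) ^ (-(2 * γ)) * (6 / δ) ^ d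
      = (2 : ℝ) ^ (2 * γ + d) * (δ ^ (-(2 * γ)) * (3 / δ) ^ d) := by
  rw [Real.div_rpow hδ.le (by norm_num), Real.rpow_neg (by norm_num : (0 : ℝ) ≤ 2), div_inv_eq_mul,
    Real.rpow_add (by norm_num), Real.rpow_natCast, show (6 : ℝ) / δ = 2 * (3 / δ) by ring, mul_pow]
  ring

/-- The left side is `[T, U (1 + W)]` by the product rule; the right side is the commutator required
of the next state. -/
theorem commutator_identity {R : Type*} [Ring R] {U V D P W D' P' : R}
    (h : (1 + W) * P' = P * W - W * D') :
    (U * (D + P) - V * U) * (1 + W) + U * (D' - P - D * W + W * D)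
      = U * (1 + W) * (D + D' + P') - V * (U * (1 + W)) := by
  have e : U * (1 + W) * (D + D' + P')
      = U * ((1 + W) * (D + D')) + U * ((1 + W) * P') := by noncomm_ring
  rw [e, h]
  noncomm_ring

/-- One factor `(1 / (4 * K)) ^ j` cancels the growth `K ^ j` of the cost and leaves `(1 / 4) ^ j`.
In the quadratic bound the second such factor survives, and the smallness of `E` supplies the
additional `1 / (4 * K)`. -/
theorem step_bounds {q E s K A : ℝ} (hE : 0 ≤ E) (hK : 0 < K) (d j : ℕ)
    (hA : A = 3 ^ d * s * K ^ (j + 1)) (h : 4 * q * 3 ^ d * s * K ^ 2 * E ≤ 1 / 4) :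
    q * (K * A) * (E * (1 / (4 * K)) ^ j) ≤ 1 / 16 * (1 / 4) ^ j ∧
      4 * q * A * (E * (1 / (4 * K)) ^ j) ^ 2 ≤ E * (1 / (4 * K)) ^ (j + 1) := by
  have hKj : (K : ℝ) ^ j * (1 / (4 * K)) ^ j = (1 / 4) ^ j := by
    rw [← mul_pow]; congr 1; field_simp
  have hj : (1 / 4 : ℝ) ^ j ≤ 1 := pow_le_one₀ (by norm_num) (by norm_num)
  constructor
  · calc q * (K * A) * (E * (1 / (4 * K)) ^ j)
        = (4 * q * 3 ^ d * s * K ^ 2 * E) * (1 / 4) * (K ^ j * (1 / (4 * K)) ^ j) := by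
          rw [hA]; ring
      _ ≤ 1 / 4 * (1 / 4) * (K ^ j * (1 / (4 * K)) ^ j) := by gcongr
      _ = _ := by rw [hKj]; ring
  · calc 4 * q * A * (E * (1 / (4 * K)) ^ j) ^ 2
        = (4 * q * 3 ^ d * s * K ^ 2 * E) * (1 / K) * E * (1 / (4 * K)) ^ j
            * (K ^ j * (1 / (4 * K)) ^ j) := by
          rw [hA, show K ^ 2 = K * K by ring]
          have : K * (1 / K) = 1 := by field_simp
          linear_combination (-4 * q * 3 ^ d * s * K * E ^ 2 * ((1 / (4 * K)) ^ j) ^ 2 * K ^ j)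
            * this
      _ ≤ 1 / 4 * (1 / K) * E * (1 / (4 * K)) ^ j * 1 := by rw [hKj]; gcongr
      _ = _ := by rw [pow_succ]; field_simp

theorem norm_mul_one_add_sub {R : Type*} [NormedRing R] (U W : R) :
    ‖U * (1 + W) - 1‖ ≤ ‖U - 1‖ + ‖U * W‖ := by
  rw [mul_add, mul_one, add_sub_right_comm]
  exact norm_add_le _ _

theorem IterationState.Bounds.next {lam : Lattice d → ℝ} {V : EllTwo d →L[ℂ] EllTwo d}
    {α σ E K : ℝ} {j : ℕ} (hE : 0 ≤ E) (hK2 : 2 ≤ K) (hασ : 0 ≤ α - σ) {S : IterationState d}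
    (hS : S.Bounds lam V α σ E K j) {W P' D' : EllTwo d →L[ℂ] EllTwo d} (hD' : IsDiagonal D')
    (hD's : shapeNorm lam 0 D' ≤ ENNReal.ofReal (E * (1 / (4 * K)) ^ j))
    (hD'n : ‖D'‖ ≤ E * (1 / (4 * K)) ^ j)
    (hW : IsCommutator lam W (D' - S.P - S.D * W + W * S.D))
    (hP' : (1 + W) * P' = S.P * W - W * D')
    (hWα : sumNorm lam (α - σ) W ≤ ENNReal.ofReal (1 / 16 * (1 / 4) ^ j))
    (hP's : shapeNorm lam (α - σ * (1 - (1 / 2) ^ (j + 1))) P'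
      ≤ ENNReal.ofReal (E * (1 / (4 * K)) ^ (j + 1))) :
    IterationState.Bounds lam V α σ E K (j + 1) ⟨S.D + D', P', S.U * (1 + W)⟩ ∧
      ‖S.U - S.U * (1 + W)‖ ≤ 1 * (1 / 4) ^ j ∧ ‖S.D - (S.D + D')‖ ≤ E * (1 / 8) ^ j := by
  obtain ⟨D, P, U⟩ := S
  obtain ⟨hD, hDs, hP, hcomm, hU1, hUs⟩ := hS
  simp only at hD hDs hP hcomm hU1 hUs hP' hW ⊢
  have hp0 : 0 ≤ E * (1 / (4 * K)) ^ j := by positivity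
  -- Here `2 ≤ K` is what yields the ratio 1/8.
  have hp8 : E * (1 / (4 * K)) ^ j ≤ E * (1 / 8) ^ j := by
    gcongr; linarith
  have hj4 : (1 / 4 : ℝ) ^ j ≤ 1 := pow_le_one₀ (by norm_num) (by norm_num)
  have hj40 : (0 : ℝ) < (1 / 4) ^ j := by positivity
  have hWn : ‖W‖ ≤ 1 / 16 * (1 / 4) ^ j := by
    have := (enorm_le_sumNorm hασ lam W).trans hWα
    rwa [← ofReal_norm, ENNReal.ofReal_le_ofReal_iff (by positivity)] at this
  have hUn : ‖U‖ ≤ 3 / 2 := by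
    have h1 : ‖U‖ ≤ ‖U - 1‖ + ‖(1 : EllTwo d →L[ℂ] EllTwo d)‖ := by
      simpa using norm_add_le (U - 1) 1
    have h2 : ‖(1 : EllTwo d →L[ℂ] EllTwo d)‖ ≤ 1 := ContinuousLinearMap.norm_id_le
    linarith
  have hUW : ‖U * W‖ ≤ 3 / 2 * (1 / 16 * (1 / 4) ^ j) :=
    (norm_mul_le _ _).trans (mul_le_mul hUn hWn (norm_nonneg _) (by norm_num))
  refine ⟨⟨?_, ?_, hP's, ?_, ?_, ?_⟩, ?_, ?_⟩
  · intro m n hmn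
    rw [entry_add, hD m n hmn, hD' m n hmn, add_zero]
  · refine (shapeNorm_add_le lam 0 _ _).trans ((add_le_add hDs hD's).trans ?_)
    have h8 : (1 / 8 : ℝ) ^ j ≤ 1 := pow_le_one₀ (by norm_num) (by norm_num)
    rw [← ENNReal.ofReal_add (mul_nonneg (by positivity) (by linarith)) hp0]
    refine ENNReal.ofReal_le_ofReal ?_
    rw [pow_succ]
    linarith
  · have := hcomm.mul ((isCommutator_one lam).add hW)
    rwa [zero_add, commutator_identity hP'] at this
  · refine (norm_mul_one_add_sub U W).trans ((add_le_add hU1 hUW).trans ?_)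
    rw [pow_succ]; linarith
  · have h1 : shapeNorm lam (α - σ) (U * (1 + W)) ≤ ENNReal.ofReal (2 - (1 / 4) ^ j)
        + ENNReal.ofReal (2 - (1 / 4) ^ j) * ENNReal.ofReal (1 / 16 * (1 / 4) ^ j) := by
      rw [mul_add, mul_one]
      exact (shapeNorm_add_le lam _ _ _).trans (add_le_add hUs
        ((shapeNorm_mul_le' hασ lam U W).trans (mul_le_mul' hUs hWα)))
    refine h1.trans ?_
    rw [← ENNReal.ofReal_mul (by linarith), ← ENNReal.ofReal_add (by linarith)
      (mul_nonneg (by linarith) (by positivity))]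
    refine ENNReal.ofReal_le_ofReal ?_
    rw [pow_succ]
    nlinarith
  · rw [mul_add, mul_one, sub_add_cancel_left, norm_neg]
    linarith
  · rw [sub_add_cancel_left, norm_neg]
    exact hD'n.trans hp8

theorem IsDiophantine.exists_next {lam : Lattice d → ℝ} {c γ : ℝ} (h : IsDiophantine lam c γ)
    (hd : 1 ≤ d) {V : EllTwo d →L[ℂ] EllTwo d} {α σ E : ℝ} (hσ : 0 < σ) (hσ1 : σ ≤ 1)
    (hσα : 2 * σ ≤ α) (hE : 0 ≤ E) (hE1 : 8 / 7 * E ≤ 1 / (4 * c))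
    (hE2 : 4 * (12 * c ^ 2 * gConst γ) * 3 ^ d * σ ^ (-(2 * γ + d)) *
      ((2 : ℝ) ^ (2 * γ + d)) ^ 2 * E ≤ 1 / 4) (j : ℕ) (S : IterationState d)
    (hS : S.Bounds lam V α σ E (2 ^ (2 * γ + d)) j) :
    ∃ S' : IterationState d, S'.Bounds lam V α σ E (2 ^ (2 * γ + d)) (j + 1) ∧
      ‖S.U - S'.U‖ ≤ 1 * (1 / 4) ^ j ∧ ‖S.D - S'.D‖ ≤ E * (1 / 8) ^ j := by
  have hg := gConst_pos h.pos
  have hc := h.one_le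
  have hK2 : (2 : ℝ) ≤ 2 ^ (2 * γ + d) := by
    have h1 : (1 : ℝ) ≤ d := by exact_mod_cast hd
    calc (2 : ℝ) = 2 ^ (1 : ℝ) := by simp
      _ ≤ _ := Real.rpow_le_rpow_of_exponent_le (by norm_num) (by linarith [h.pos])
  have hδ : 0 < σ * (1 / 2) ^ (j + 1) := by positivity
  obtain ⟨hω, hp'⟩ := step_bounds (q := 12 * c ^ 2 * gConst γ) hE (by linarith)
    d j (rpow_step hσ d j) hE2
  rw [← rpow_half_step hδ d, ← mul_assoc (12 * c ^ 2 * gConst γ)] at hω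
  have hj2 : (1 / 2 : ℝ) ^ (j + 1) ≤ 1 := pow_le_one₀ (by norm_num) (by norm_num)
  have hj4 : (1 / 4 : ℝ) ^ j ≤ 1 := pow_le_one₀ (by norm_num) (by norm_num)
  have hδσ : σ * (1 / 2) ^ (j + 1) ≤ σ := mul_le_of_le_one_right hσ.le hj2
  have hsub : α - σ * (1 - (1 / 2) ^ j) - σ * (1 / 2) ^ (j + 1)
      = α - σ * (1 - (1 / 2) ^ (j + 1)) := by
    rw [pow_succ]; ring
  have hsσ : α - σ ≤ α - σ * (1 - (1 / 2) ^ (j + 1)) := by linarith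
  have hDs : shapeNorm lam 0 S.D ≤ ENNReal.ofReal (1 / (4 * c)) :=
    hS.shapeNorm_D.trans (ENNReal.ofReal_le_ofReal ((mul_le_of_le_one_right (by positivity)
      (sub_le_self _ (by positivity))).trans hE1))
  obtain ⟨W, P', D', hD', hD's, hD'n, hW, hP', hWs, hP's⟩ := h.exists_step S.D S.P hS.isDiagonal
    hDs hδ (hδσ.trans hσ1) (by linarith) (by positivity) hS.shapeNorm_P hω (by linarith)
  rw [hsub] at hWs hP's
  exact ⟨_, hS.next hE hK2 (by linarith) hD' hD's hD'n hW hP'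
    ((sumNorm_mono hsσ lam W).trans hWs) (hP's.trans (ENNReal.ofReal_le_ofReal hp'))⟩

/-! ### The limit of the iteration. -/

theorem IsCommutator.of_tendsto {lam : Lattice d → ℝ} {U B : ℕ → EllTwo d →L[ℂ] EllTwo d}
    {U' B' : EllTwo d →L[ℂ] EllTwo d} (h : ∀ n, IsCommutator lam (U n) (B n))
    (hU : Tendsto U atTop (𝓝 U')) (hB : Tendsto B atTop (𝓝 B')) : IsCommutator lam U' B' := by
  intro m n
  refine tendsto_nhds_unique ((((continuous_entry m n).tendsto _).comp hU).const_mul _) ?_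
  convert ((continuous_entry m n).tendsto _).comp hB using 2 with i
  exact h i m n

/-- The limit of the iteration: a bounded invertible operator `U` and a bounded diagonal operator
`D` with `(T + V) U = U (T + D)`. -/
theorem IsDiophantine.exists_conjugation {lam : Lattice d → ℝ} {c γ : ℝ}
    (h : IsDiophantine lam c γ)
    (hd : 1 ≤ d) {V : EllTwo d →L[ℂ] EllTwo d} {α σ E : ℝ} (hσ : 0 < σ) (hσ1 : σ ≤ 1)
    (hσα : 2 * σ ≤ α) (hE : 0 ≤ E) (hE1 : 8 / 7 * E ≤ 1 / (4 * c))
    (hE2 : 4 * (12 * c ^ 2 * gConst γ) * 3 ^ d * σ ^ (-(2 * γ + d)) *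
      ((2 : ℝ) ^ (2 * γ + d)) ^ 2 * E ≤ 1 / 4)
    (hV : shapeNorm lam α V ≤ ENNReal.ofReal E) :
    ∃ D U : EllTwo d →L[ℂ] EllTwo d, IsDiagonal D ∧
      seqNorm lam (diagonal D 0) ≤ ENNReal.ofReal (1 / (4 * c)) ∧
      IsCommutator lam U (U * D - V * U) ∧ IsUnit U ∧
      shapeNorm lam (α - σ) U ≤ ENNReal.ofReal 2 := by
  set K : ℝ := 2 ^ (2 * γ + d) with hK
  have hK1 : 1 ≤ K := Real.one_le_rpow (by norm_num) (by have := h.pos; positivity)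
  have h0 : IterationState.Bounds lam V α σ E K 0 ⟨0, V, 1⟩ :=
    ⟨fun m n _ => by simp [entry_eq], by simp [shapeNorm_zero], by simpa using hV,
      by simpa using isCommutator_one lam, by simp,
      (shapeNorm_one_le lam _).trans (by norm_num)⟩
  -- The successor is a total function of `j` and the state; its properties are available only for
  -- states satisfying the bounds, so these are proved along the sequence.
  choose! next hnext using fun j S => h.exists_next hd hσ hσ1 hσα hE hE1 hE2 j S
  let S : ℕ → IterationState d := fun n => Nat.rec ⟨0, V, 1⟩ (fun j S => next j S) n
  have hS : ∀ j, (S j).Bounds lam V α σ E K j := fun j => by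
    induction j with
    | zero => exact h0
    | succ j ih => exact (hnext j _ ih).1
  obtain ⟨U, hU⟩ := cauchySeq_tendsto_of_complete (cauchySeq_of_le_geometric (1 / 4) 1
    (by norm_num) (f := fun j => (S j).U) fun j => by
      rw [dist_eq_norm]; exact (hnext j _ (hS j)).2.1)
  obtain ⟨D, hD⟩ := cauchySeq_tendsto_of_complete (cauchySeq_of_le_geometric (1 / 8) E
    (by norm_num) (f := fun j => (S j).D) fun j => by
      rw [dist_eq_norm]; exact (hnext j _ (hS j)).2.2)
  have hP : Tendsto (fun j => (S j).P) atTop (𝓝 0) := by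
    -- The weight `α - σ` remains after all steps. A further `σ` is spent on reaching the operator
    -- norm, which is possible because `2 * σ ≤ α`.
    have hb : ∀ j, ‖(S j).P‖ ≤ (3 / σ) ^ d * (E * (1 / (4 * K)) ^ j) := fun j => by
      have hj : (0 : ℝ) ≤ σ * (1 / 2) ^ j := by positivity
      have h1 := (shapeNorm_mono (s := α - σ) (t := α - σ * (1 - (1 / 2) ^ j)) (by linarith)
        lam (S j).P).trans (hS j).shapeNorm_P
      have h2 := (enorm_le_sumNorm (by linarith) lam (S j).P).trans
        ((sumNorm_le_shapeNorm hσ hσ1 lam (S j).P).trans (mul_le_mul_right h1 _))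
      rwa [← ofReal_norm, ← ENNReal.ofReal_mul (by positivity),
        ENNReal.ofReal_le_ofReal_iff (by positivity)] at h2
    refine squeeze_zero_norm hb ?_
    have := tendsto_pow_atTop_nhds_zero_of_lt_one (r := 1 / (4 * K)) (by positivity)
      (by rw [div_lt_one (by positivity)]; linarith)
    simpa using (this.const_mul E).const_mul ((3 / σ) ^ d)
  refine ⟨D, U, fun m n hmn => ?_, ?_, ?_, ?_, ?_⟩
  · refine tendsto_nhds_unique (((continuous_entry m n).tendsto _).comp hD) ?_
    refine tendsto_const_nhds.congr fun j => ((hS j).isDiagonal m n hmn).symm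
  · refine (seqNorm_diagonal_zero_le lam 0 D).trans (shapeNorm_le_of_tendsto hD fun j =>
      (hS j).shapeNorm_D.trans (ENNReal.ofReal_le_ofReal ((mul_le_of_le_one_right (by positivity)
      (sub_le_self _ (by positivity))).trans hE1)))
  · refine IsCommutator.of_tendsto (fun j => (hS j).isCommutator) hU ?_
    simpa using (hU.mul (hD.add hP)).sub (hU.const_mul V)
  · have h1 : ‖U - 1‖ ≤ 1 / 2 := by
      refine le_of_tendsto (hU.sub_const 1).norm (Eventually.of_forall fun j =>
        (hS j).norm_sub_one.trans ?_)
      have : (0 : ℝ) < (1 / 4) ^ j := by positivity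
      linarith
    have h2 : IsUnit (1 - (1 - U)) := isUnit_one_sub_of_norm_lt_one (by
      rw [norm_sub_rev]; linarith)
    simpa using h2
  · exact shapeNorm_le_of_tendsto hU fun j => (hS j).shapeNorm_U.trans
      (ENNReal.ofReal_le_ofReal (sub_le_self _ (by positivity)))

/-! ### Domains and the conjugation of unbounded operators. -/

theorem memℓp_congr {f g : Lattice d → ℂ} (h : ∀ n, f n = g n) (hf : Memℓp f 2) : Memℓp g 2 := by
  rwa [← funext h]

theorem diagOp_apply {μ : Lattice d → ℂ} (v : (diagOp μ).domain) (n : Lattice d) :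
    diagOp μ v n = μ n * (v : EllTwo d) n := rfl

theorem IsCommutator.apply {lam : Lattice d → ℝ} {U B : EllTwo d →L[ℂ] EllTwo d}
    (h : IsCommutator lam U B) {x y : EllTwo d} (hy : ∀ n, y n = lam n * x n) (m : Lattice d) :
    lam m * U x m = U y m + B x m := by
  refine ((hasSum_apply U x m).mul_left _).unique ?_
  refine ((hasSum_apply U y m).add (hasSum_apply B x m)).congr_fun fun l => ?_
  rw [hy, ← h]; ring

/-- The resolvent of a real diagonal operator at a point of the imaginary axis. -/
theorem exists_resolvent (lam : Lattice d → ℝ) {t : ℝ} (ht : 0 < t) :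
    ∃ R : EllTwo d →L[ℂ] EllTwo d, (∀ v n, (lam n - t * Complex.I) * R v n = v n) ∧
      ‖R‖ ≤ 1 / t := by
  have him : ∀ n, t ≤ ‖(lam n - t * Complex.I : ℂ)‖ := fun n => by
    have := Complex.abs_im_le_norm (lam n - t * Complex.I : ℂ)
    simpa [abs_of_pos ht] using this
  obtain ⟨R, hR, hRn⟩ := exists_diagonal (fun n => 1 / (lam n - t * Complex.I : ℂ)) (1 / t)
    fun n => by rw [norm_div, norm_one]; exact one_div_le_one_div_of_le ht (him n)
  refine ⟨R, fun v n => ?_, hRn⟩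
  have : (lam n - t * Complex.I : ℂ) ≠ 0 := norm_pos_iff.1 (ht.trans_le (him n))
  rw [hR]; field_simp

/-- An invertible operator with bounded commutator preserves the domain of the diagonal operator. -/
theorem IsCommutator.memℓp_iff {lam : Lattice d → ℝ} {B : EllTwo d →L[ℂ] EllTwo d}
    {U : EllTwo d ≃L[ℂ] EllTwo d} (h : IsCommutator lam U B) (x : EllTwo d) :
    Memℓp (fun n => (lam n : ℂ) * U x n) 2 ↔ Memℓp (fun n => (lam n : ℂ) * x n) 2 := by
  constructor
  · intro hx
    set b := ‖B‖ * ‖(U.symm : EllTwo d →L[ℂ] EllTwo d)‖ with hb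
    have ht : 0 < b + 1 := by positivity
    set t := b + 1
    obtain ⟨R, hR, hRn⟩ := exists_resolvent lam ht
    have h0 : ∀ n, (lam n - t * Complex.I : ℂ) ≠ 0 := fun n hn => by
      have := congrArg Complex.im hn
      simp at this
      exact ht.ne' this
    -- With `R = (T - it)⁻¹`, this is `(T - it) U R = U + B R`.
    have hint : ∀ v, U (R v) = R (U v + B (R v)) := fun v => by
      ext m
      have h1 := h.apply (x := R v) (y := v + (t * Complex.I) • R v)
        (fun n => by
          have := hR v n
          simp only [lp.coeFn_add, lp.coeFn_smul, Pi.add_apply, Pi.smul_apply, smul_eq_mul]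
          rw [← this]; ring) m
      have h2 := hR (U v + B (R v)) m
      refine mul_left_cancel₀ (h0 m) ?_
      rw [h2]
      simp only [ContinuousLinearEquiv.coe_coe, map_add, map_smul, lp.coeFn_add, lp.coeFn_smul,
        Pi.add_apply, Pi.smul_apply, smul_eq_mul] at h1 ⊢
      linear_combination h1
    -- Since `‖R‖ ≤ 1 / t`, the choice `t = b + 1` makes `1 + B R U⁻¹`, and hence `U + B R`,
    -- invertible. Every vector in the range of `R`, the domain of `T`, is then `U` of a vector in
    -- that domain.
    have hN : ‖-(B * R * (U.symm : EllTwo d →L[ℂ] EllTwo d))‖ < 1 := by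
      rw [norm_neg]
      calc ‖B * R * (U.symm : EllTwo d →L[ℂ] EllTwo d)‖
          ≤ ‖B‖ * (1 / t) * ‖(U.symm : EllTwo d →L[ℂ] EllTwo d)‖ :=
            (norm_mul_le _ _).trans (by gcongr; exact (norm_mul_le _ _).trans (by gcongr))
        _ = b / t := by rw [hb]; ring
        _ < 1 := by rw [div_lt_one ht]; exact lt_add_one b
    obtain ⟨Z, hZ⟩ := isUnit_one_sub_of_norm_lt_one hN
    let w : EllTwo d := ⟨_, hx⟩
    set v : EllTwo d := w - (t * Complex.I) • U x with hv
    have hRv : R v = U x := by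
      ext n
      refine mul_left_cancel₀ (h0 n) ?_
      rw [hR]
      simp only [hv, w, lp.coeFn_sub, lp.coeFn_smul, Pi.sub_apply, Pi.smul_apply, smul_eq_mul]
      ring
    set v' := U.symm ((↑Z⁻¹ : EllTwo d →L[ℂ] EllTwo d) v) with hv'
    have hv'' : U v' + B (R v') = v := by
      have h1 : (Z : EllTwo d →L[ℂ] EllTwo d) ((↑Z⁻¹ : EllTwo d →L[ℂ] EllTwo d) v) = v := by
        rw [← mul_apply_eq_comp, Z.mul_inv]; rfl
      rw [hZ, sub_neg_eq_add] at h1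
      simpa [hv'] using h1
    have hx' : x = R v' := by
      apply U.injective
      rw [hint, hv'', hRv]
    have := lp.memℓp (v' + (t * Complex.I) • R v')
    refine memℓp_congr (fun n => ?_) this
    have h3 := hR v' n
    simp only [lp.coeFn_add, lp.coeFn_smul, Pi.add_apply, Pi.smul_apply, smul_eq_mul, hx']
    linear_combination -h3
  · intro hx
    let y : EllTwo d := ⟨_, hx⟩
    exact memℓp_congr (fun n => (h.apply (x := x) (y := y) (fun _ => rfl) n).symm)
      (lp.memℓp ((U : EllTwo d →L[ℂ] EllTwo d) y + B x))

theorem IsCommutator.conj_eq {lam : Lattice d → ℝ} {V D : EllTwo d →L[ℂ] EllTwo d} {ε : ℝ}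
    {U : EllTwo d ≃L[ℂ] EllTwo d} (hD : IsDiagonal D)
    (h : IsCommutator lam U (U * D - ((ε : ℂ) • V) * U)) :
    conj U (perturbed (diagOp fun n => (lam n : ℂ)) V ε)
      = diagOp fun n => (lam n : ℂ) + entry D n n := by
  -- Adding the bounded operator `D` does not change the domain.
  have hdom : ∀ x : EllTwo d, Memℓp (fun n => (lam n : ℂ) * x n) 2 ↔
      Memℓp (fun n => ((lam n : ℂ) + entry D n n) * x n) 2 := fun x => by
    constructor
    · intro hx
      let y : EllTwo d := ⟨_, hx⟩
      refine memℓp_congr (fun n => ?_) (lp.memℓp (y + D x))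
      simp only [lp.coeFn_add, Pi.add_apply, y, hD.apply]; ring
    · intro hx
      let y : EllTwo d := ⟨_, hx⟩
      refine memℓp_congr (fun n => ?_) (lp.memℓp (y - D x))
      simp only [lp.coeFn_sub, Pi.sub_apply, y, hD.apply]; ring
  refine LinearPMap.ext (Submodule.ext fun x => (h.memℓp_iff x).trans (hdom x)) ?_
  intro x hf hg
  have hx : Memℓp (fun n => (lam n : ℂ) * x n) 2 := (hdom x).2 hg
  let y : EllTwo d := ⟨_, hx⟩
  apply U.injective
  have e1 : U (conj U (perturbed (diagOp fun n => (lam n : ℂ)) V ε) ⟨x, hf⟩)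
      = diagOp (fun n => (lam n : ℂ)) ⟨U x, hf⟩ + (ε : ℂ) • V (U x) :=
    U.apply_symm_apply _
  have e2 : diagOp (fun n => (lam n : ℂ) + entry D n n) ⟨x, hg⟩ = y + D x := by
    ext n
    rw [diagOp_apply]
    simp only [lp.coeFn_add, Pi.add_apply, y, hD.apply]; ring
  rw [e1, e2]
  ext m
  have := h.apply (x := x) (y := y) (fun _ => rfl) m
  simp only [lp.coeFn_add, Pi.add_apply, diagOp_apply, map_add]
  simp only [sub_apply, mul_apply_eq_comp, ContinuousLinearEquiv.coe_coe,
    lp.coeFn_sub, Pi.sub_apply, smul_apply] at this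
  linear_combination this

/-! ### Spectral consequences of being similar to a diagonal operator. -/

section Spectral

variable {A : EllTwo d →ₗ.[ℂ] EllTwo d} {U : EllTwo d ≃L[ℂ] EllTwo d} {μ : Lattice d → ℂ}

theorem mem_eigenspace_iff {z : ℂ} {x : EllTwo d} :
    x ∈ eigenspace A z ↔ ∃ h : x ∈ A.domain, A ⟨x, h⟩ = z • x := by
  constructor
  · rintro ⟨y, hy, rfl⟩
    exact ⟨y.2, sub_eq_zero.1 hy⟩
  · rintro ⟨h, hx⟩
    exact ⟨⟨x, h⟩, sub_eq_zero.2 hx, rfl⟩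

theorem apply_mem_domain_iff (h : conj U A = diagOp μ) (x : EllTwo d) :
    U x ∈ A.domain ↔ Memℓp (fun n => μ n * x n) 2 := by
  have := congrArg LinearPMap.domain h
  exact SetLike.ext_iff.1 this x

theorem symm_apply_apply (h : conj U A = diagOp μ) (x : EllTwo d) (hx : U x ∈ A.domain)
    (n : Lattice d) : U.symm (A ⟨U x, hx⟩) n = μ n * x n := by
  obtain ⟨_, h2⟩ := LinearPMap.ext_iff.1 h
  exact congrArg (fun v : EllTwo d => v n)
    (@h2 x hx ((apply_mem_domain_iff h x).1 hx))

theorem apply_mem_eigenspace_iff (h : conj U A = diagOp μ) (x : EllTwo d) (z : ℂ) :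
    U x ∈ eigenspace A z ↔ ∀ n, μ n * x n = z * x n := by
  rw [mem_eigenspace_iff]
  constructor
  · rintro ⟨hx, e⟩ n
    rw [← symm_apply_apply h x hx, e, map_smul, U.symm_apply_apply]
    rfl
  · intro hn
    have hx : U x ∈ A.domain := (apply_mem_domain_iff h x).2
      (memℓp_congr (fun n => (hn n).symm) (lp.memℓp (z • x)))
    refine ⟨hx, U.symm.injective ?_⟩
    ext n
    rw [symm_apply_apply h, hn, map_smul, U.symm_apply_apply]
    rfl

theorem apply_e_mem_eigenspace (h : conj U A = diagOp μ) (n : Lattice d) :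
    U (e n) ∈ eigenspace A (μ n) := by
  rw [apply_mem_eigenspace_iff h]
  intro m
  rw [e_apply]
  split_ifs with hm <;> simp [hm]

theorem apply_e_ne_zero (U : EllTwo d ≃L[ℂ] EllTwo d) (n : Lattice d) : U (e n) ≠ 0 := by
  rw [Ne, U.map_eq_zero_iff, ← norm_eq_zero, norm_e]
  exact one_ne_zero

theorem eigenvalues_eq (h : conj U A = diagOp μ) : eigenvalues A = Set.range μ := by
  ext z
  constructor
  · intro hz
    obtain ⟨x, hx, hx0⟩ := Submodule.exists_mem_ne_zero_of_ne_bot hz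
    rw [← U.apply_symm_apply x, apply_mem_eigenspace_iff h] at hx
    by_contra hne
    apply hx0
    rw [← U.symm.map_eq_zero_iff]
    ext n
    by_contra hn
    exact hne ⟨n, mul_right_cancel₀ hn (hx n)⟩
  · rintro ⟨n, rfl⟩
    exact (Submodule.ne_bot_iff _).2 ⟨_, apply_e_mem_eigenspace h n, apply_e_ne_zero U n⟩

theorem eigenspace_eq_span (h : conj U A = diagOp μ) (hμ : Function.Injective μ) (n : Lattice d) :
    eigenspace A (μ n) = Submodule.span ℂ {U (e n)} := by
  refine le_antisymm (fun x hx => ?_)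
    ((Submodule.span_singleton_le_iff_mem _ _).2 (apply_e_mem_eigenspace h n))
  rw [← U.apply_symm_apply x, apply_mem_eigenspace_iff h] at hx
  refine Submodule.mem_span_singleton.2 ⟨U.symm x n, ?_⟩
  rw [← map_smul, ← U.apply_symm_apply x]
  congr 1
  ext m
  rw [U.symm_apply_apply, lp.coeFn_smul, Pi.smul_apply, e_apply, smul_eq_mul]
  split_ifs with hm
  · rw [hm, mul_one]
  · rw [mul_zero]
    by_contra hne
    exact hm (hμ (mul_right_cancel₀ (Ne.symm hne) (hx m)))

theorem hasSimpleEigenvalues (h : conj U A = diagOp μ) (hμ : Function.Injective μ) :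
    HasSimpleEigenvalues A := by
  intro z hz
  rw [eigenvalues_eq h] at hz
  obtain ⟨n, rfl⟩ := hz
  refine ⟨?_, fun x hx => ?_⟩
  · rw [eigenspace_eq_span h hμ, finrank_span_singleton (apply_e_ne_zero U n)]
  · obtain ⟨x, hxd⟩ := x
    obtain ⟨x, rfl⟩ := U.surjective x
    rw [← U.apply_symm_apply (A _ - _), apply_mem_eigenspace_iff h] at hx
    rw [apply_mem_eigenspace_iff h]
    intro m
    have := hx m
    rw [map_sub, map_smul, U.symm_apply_apply, lp.coeFn_sub, Pi.sub_apply,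
      symm_apply_apply h, lp.coeFn_smul, Pi.smul_apply, smul_eq_mul] at this
    -- In diagonal coordinates `A - μ n` acts by multiplication, and a number whose product with `x
    -- m` is annihilated by itself already annihilates `x m`.
    have h2 : (μ m - μ n) * ((μ m - μ n) * x m) = 0 := by linear_combination this
    rcases mul_eq_zero.1 h2 with h3 | h3
    · rw [sub_eq_zero.1 h3]
    · linear_combination h3

theorem span_apply_e_dense (U : EllTwo d ≃L[ℂ] EllTwo d) :
    (Submodule.span ℂ (Set.range fun n => U (e n))).topologicalClosure = ⊤ := by
  rw [eq_top_iff]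
  intro v _
  have h := (U : EllTwo d →L[ℂ] EllTwo d).hasSum (hasSum_e (U.symm v))
  rw [ContinuousLinearEquiv.coe_coe, U.apply_symm_apply] at h
  refine mem_closure_of_tendsto h (Eventually.of_forall fun s => ?_)
  refine Submodule.sum_mem _ fun n _ => ?_
  rw [map_smul]
  exact Submodule.smul_mem _ _ (Submodule.subset_span ⟨n, rfl⟩)

theorem spectrum_eq (h : conj U A = diagOp μ) : spectrum A = closure (Set.range μ) := by
  ext z
  rw [← not_iff_not]
  constructor
  · intro hz hcl
    obtain ⟨R, -, hR⟩ := not_not.1 hz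
    obtain ⟨n, hn⟩ := Metric.mem_closure_range_iff.1 hcl (1 / (‖R‖ + 1)) (by positivity)
    obtain ⟨hd, he⟩ := mem_eigenspace_iff.1 (apply_e_mem_eigenspace h n)
    have h1 : R (A ⟨U (e n), hd⟩ - z • U (e n)) = U (e n) := hR ⟨_, hd⟩
    rw [he, ← sub_smul, map_smul] at h1
    -- A bounded inverse of `A - z` tested on the eigenvectors keeps `z` at a positive distance from
    -- all `μ n`.
    have h2 : ‖U (e n)‖ ≤ ‖μ n - z‖ * (‖R‖ * ‖U (e n)‖) := by
      conv_lhs => rw [← h1]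
      rw [norm_smul]
      gcongr
      exact R.le_opNorm _
    have h3 : 0 < ‖U (e n)‖ := norm_pos_iff.2 (apply_e_ne_zero U n)
    rw [dist_comm, dist_eq_norm, lt_div_iff₀ (by positivity)] at hn
    have h4 := norm_nonneg (μ n - z)
    nlinarith
  · intro hcl
    rw [Metric.mem_closure_range_iff] at hcl
    push Not at hcl
    obtain ⟨r, hr, hrn⟩ := hcl
    have hne : ∀ n, μ n - z ≠ 0 := fun n => by
      have := hrn n
      rw [dist_comm, dist_eq_norm] at this
      exact norm_pos_iff.1 (hr.trans_le this)
    obtain ⟨M, hM, -⟩ := exists_diagonal (fun n => 1 / (μ n - z)) (1 / r) fun n => by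
      have := hrn n
      rw [dist_comm, dist_eq_norm] at this
      rw [norm_div, norm_one]
      exact one_div_le_one_div_of_le hr this
    have hM' : ∀ v n, (μ n - z) * M v n = v n := fun v n => by
      rw [hM]; have := hne n; field_simp
    refine not_not.2 ⟨(U : EllTwo d →L[ℂ] EllTwo d) * M * (U.symm : EllTwo d →L[ℂ] EllTwo d),
      fun y => ?_, fun x => ?_⟩
    · have hd : U (M (U.symm y)) ∈ A.domain := (apply_mem_domain_iff h _).2 (memℓp_congr
        (fun n => by
          rw [lp.coeFn_add, lp.coeFn_smul, Pi.add_apply, Pi.smul_apply, smul_eq_mul]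
          linear_combination - hM' (U.symm y) n)
        (lp.memℓp (U.symm y + z • M (U.symm y))))
      refine ⟨hd, U.symm.injective ?_⟩
      ext n
      change U.symm (A ⟨U (M (U.symm y)), hd⟩ - z • U (M (U.symm y))) n = _
      rw [map_sub, map_smul, U.symm_apply_apply, lp.coeFn_sub, lp.coeFn_smul, Pi.sub_apply,
        symm_apply_apply h, Pi.smul_apply, smul_eq_mul]
      linear_combination hM' (U.symm y) n
    · obtain ⟨x, hxd⟩ := x
      obtain ⟨x, rfl⟩ := U.surjective x
      change U (M (U.symm (A ⟨U x, hxd⟩ - z • U x))) = U x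
      congr 1
      ext n
      refine mul_left_cancel₀ (hne n) ?_
      rw [hM', map_sub, map_smul, U.symm_apply_apply, lp.coeFn_sub, lp.coeFn_smul, Pi.sub_apply,
        symm_apply_apply h, Pi.smul_apply, smul_eq_mul]
      ring

theorem hasPurePointSpectrum (h : conj U A = diagOp μ) : HasPurePointSpectrum A := by
  refine ⟨?_, by rw [spectrum_eq h, eigenvalues_eq h]⟩
  rw [eq_top_iff, ← span_apply_e_dense U]
  refine Submodule.topologicalClosure_mono (Submodule.span_le.2 ?_)
  rintro _ ⟨n, rfl⟩
  exact Submodule.mem_iSup_of_mem (μ n) (apply_e_mem_eigenspace h n)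

end Spectral

/-! ### The self-adjoint case. -/

theorem inner_perturbed {lam : Lattice d → ℝ} {V : EllTwo d →L[ℂ] EllTwo d} (hV : IsSelfAdjoint V)
    (ε : ℝ) (x y : (perturbed (diagOp fun n => (lam n : ℂ)) V ε).domain) :
    inner ℂ (perturbed (diagOp fun n => (lam n : ℂ)) V ε x) (y : EllTwo d)
      = inner ℂ (x : EllTwo d) (perturbed (diagOp fun n => (lam n : ℂ)) V ε y) := by
  obtain ⟨x, hx⟩ := x
  obtain ⟨y, hy⟩ := y
  have e : ∀ (z : EllTwo d) (hz : z ∈ (diagOp fun n => (lam n : ℂ)).domain),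
      perturbed (diagOp fun n => (lam n : ℂ)) V ε ⟨z, hz⟩
        = diagOp (fun n => (lam n : ℂ)) ⟨z, hz⟩ + (ε : ℂ) • V z := fun _ _ => rfl
  have h1 : inner ℂ (diagOp (fun n => (lam n : ℂ)) ⟨x, hx⟩) y
      = inner ℂ x (diagOp (fun n => (lam n : ℂ)) ⟨y, hy⟩) := by
    rw [lp.inner_eq_tsum, lp.inner_eq_tsum]
    refine tsum_congr fun n => ?_
    simp only [diagOp_apply, RCLike.inner_apply, map_mul, Complex.conj_ofReal]
    ring
  have h2 : inner ℂ (V x) y = inner ℂ x (V y) := by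
    rw [← ContinuousLinearMap.adjoint_inner_right, ContinuousLinearMap.isSelfAdjoint_iff'.1 hV]
  rw [e x hx, e y hy, inner_add_left, inner_add_right, h1, inner_smul_left, inner_smul_right, h2,
    Complex.conj_ofReal]

/-- Symmetry tested on `x` itself shows that `z` is real; tested on `x` and `y` it then gives
orthogonality. -/
theorem inner_eq_zero_of_mem_eigenspace {A : EllTwo d →ₗ.[ℂ] EllTwo d}
    (hA : ∀ x y : A.domain, inner ℂ (A x) (y : EllTwo d) = inner ℂ (x : EllTwo d) (A y))
    {x y : EllTwo d} {z w : ℂ} (hx : x ∈ eigenspace A z) (hy : y ∈ eigenspace A w) (hx0 : x ≠ 0)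
    (hzw : z ≠ w) : inner ℂ x y = 0 := by
  obtain ⟨hxd, hx⟩ := mem_eigenspace_iff.1 hx
  obtain ⟨hyd, hy⟩ := mem_eigenspace_iff.1 hy
  have h1 := hA ⟨x, hxd⟩ ⟨x, hxd⟩
  have h2 := hA ⟨x, hxd⟩ ⟨y, hyd⟩
  rw [hx] at h1
  rw [hx, hy] at h2
  simp only [inner_smul_left, inner_smul_right] at h1 h2
  have h3 : (starRingEnd ℂ) z = z := mul_right_cancel₀ (inner_self_ne_zero.2 hx0) h1
  rw [h3] at h2
  by_contra hne
  exact hzw (mul_right_cancel₀ hne h2)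

/-- Orthonormal columns give `U* U = 1`, and invertibility turns this left inverse into a two-sided
one. -/
theorem mem_unitary_of_orthonormal (U : EllTwo d ≃L[ℂ] EllTwo d)
    (h : Orthonormal ℂ fun n => U (e n)) :
    (U : EllTwo d →L[ℂ] EllTwo d) ∈ unitary (EllTwo d →L[ℂ] EllTwo d) := by
  have h1 : star (U : EllTwo d →L[ℂ] EllTwo d) * (U : EllTwo d →L[ℂ] EllTwo d) = 1 := by
    refine ext_entry fun m n => ?_
    rw [entry_one, ← orthonormal_iff_ite.1 h m n, entry, mul_apply_eq_comp,
      ContinuousLinearMap.star_eq_adjoint, ContinuousLinearMap.adjoint_inner_right]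
    rfl
  have h2 : (U : EllTwo d →L[ℂ] EllTwo d) * (U.symm : EllTwo d →L[ℂ] EllTwo d) = 1 := by
    ext1 v; exact U.apply_symm_apply v
  refine Unitary.mem_iff.2 ⟨h1, ?_⟩
  rwa [left_inv_eq_right_inv h1 h2]

theorem exists_diagonal_equiv (a : Lattice d → ℂ) {r C : ℝ} (hr : 0 < r)
    (h1 : ∀ n, r ≤ ‖a n‖) (h2 : ∀ n, ‖a n‖ ≤ C) :
    ∃ N : EllTwo d ≃L[ℂ] EllTwo d, ∀ v n, N v n = a n * v n := by
  obtain ⟨M, hM, -⟩ := exists_diagonal a C h2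
  obtain ⟨M', hM', -⟩ := exists_diagonal (fun n => (a n)⁻¹) r⁻¹ fun n => by
    rw [norm_inv]; exact inv_anti₀ hr (h1 n)
  have h0 : ∀ n, a n ≠ 0 := fun n => norm_pos_iff.1 (hr.trans_le (h1 n))
  refine ⟨ContinuousLinearEquiv.equivOfInverse M M' (fun v => ?_) (fun v => ?_), hM⟩
  · ext n; rw [hM', hM, inv_mul_cancel_left₀ (h0 n)]
  · ext n; rw [hM, hM', mul_inv_cancel_left₀ (h0 n)]

theorem norm_entry_le_of_shapeNorm_le {lam : Lattice d → ℝ} {s C : ℝ} (hC : 0 ≤ C)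
    {A : EllTwo d →L[ℂ] EllTwo d} (h : shapeNorm lam s A ≤ ENNReal.ofReal C) (j n : Lattice d) :
    ‖entry A j n‖ ≤ C * Real.exp (-(s * oneNorm (j - n))) := by
  have h1 : weight s (n - j) * ‖entry A j n‖ₑ ≤ ENNReal.ofReal C := by
    refine le_trans ?_ ((le_shapeNorm lam s A (n - j)).trans h)
    refine mul_le_mul_right (le_trans ?_ (supNorm_le_seqNorm lam _)) _
    simpa [diagonal] using le_supNorm (diagonal A (n - j)) j
  have h2 : oneNorm (n - j) = oneNorm (j - n) := by
    simp only [oneNorm, Pi.sub_apply, Int.cast_sub, abs_sub_comm]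
  rw [weight, h2, ← ofReal_norm, ← ENNReal.ofReal_mul (Real.exp_nonneg _),
    ENNReal.ofReal_le_ofReal_iff hC] at h1
  rw [Real.exp_neg, ← div_eq_mul_inv, le_div_iff₀ (Real.exp_pos _)]
  linarith

theorem exists_unitary_conjugation {lam : Lattice d → ℝ} {V D : EllTwo d →L[ℂ] EllTwo d} {ε : ℝ}
    {U : EllTwo d ≃L[ℂ] EllTwo d} (hV : IsSelfAdjoint V) (hD : IsDiagonal D)
    (hinj : Function.Injective fun n => (lam n : ℂ) + entry D n n)
    (h : IsCommutator lam U (U * D - ((ε : ℂ) • V) * U)) {s C : ℝ} (hC : 0 < C)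
    (hU : shapeNorm lam s (U : EllTwo d →L[ℂ] EllTwo d) ≤ ENNReal.ofReal C) :
    ∃ U' : EllTwo d ≃L[ℂ] EllTwo d,
      conj U' (perturbed (diagOp fun n => (lam n : ℂ)) V ε)
        = (diagOp fun n => (lam n : ℂ) + entry D n n) ∧
      Orthonormal ℂ (fun n => U' (e n)) ∧
      ∀ n, ∃ C : ℝ, 0 < C ∧ ∀ j, ‖(inner ℂ (e j) (U' (e n)) : ℂ)‖
        ≤ C * Real.exp (-(s * oneNorm (j - n))) := by
  have hpos : ∀ n, 0 < ‖U (e n)‖ := fun n => norm_pos_iff.2 (apply_e_ne_zero U n)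
  have hle : ∀ n, ‖U (e n)‖ ≤ ‖(U : EllTwo d →L[ℂ] EllTwo d)‖ := fun n => by
    simpa [norm_e] using (U : EllTwo d →L[ℂ] EllTwo d).le_opNorm (e n)
  have hge : ∀ n, 1 ≤ ‖(U.symm : EllTwo d →L[ℂ] EllTwo d)‖ * ‖U (e n)‖ := fun n => by
    simpa [norm_e] using (U.symm : EllTwo d →L[ℂ] EllTwo d).le_opNorm (U (e n))
  -- `N` normalizes the columns of `U`. It is boundedly invertible since `‖U e_n‖` lies between `1 /
  -- ‖U⁻¹‖` and `‖U‖`, and being diagonal it commutes with `D` and `T`, so the conjugation identity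
  -- survives.
  obtain ⟨N, hN⟩ := exists_diagonal_equiv (fun n => ((‖U (e n)‖⁻¹ : ℝ) : ℂ))
    (r := ‖(U : EllTwo d →L[ℂ] EllTwo d)‖⁻¹) (C := ‖(U.symm : EllTwo d →L[ℂ] EllTwo d)‖)
    (inv_pos.2 ((hpos 0).trans_le (hle 0)))
    (fun n => by
      rw [Complex.norm_real, norm_inv, norm_norm]
      exact inv_anti₀ (hpos n) (hle n))
    (fun n => by
      rw [Complex.norm_real, norm_inv, norm_norm, inv_le_iff_one_le_mul₀ (hpos n)]
      exact hge n)
  have hNd : IsDiagonal (N : EllTwo d →L[ℂ] EllTwo d) := fun m n hmn => by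
    rw [entry_of_apply (A := (N : EllTwo d →L[ℂ] EllTwo d)) hN, if_neg hmn]
  have hNe : ∀ n, (N.trans U) (e n) = ((‖U (e n)‖⁻¹ : ℝ) : ℂ) • U (e n) := fun n => by
    rw [ContinuousLinearEquiv.trans_apply, ← map_smul]
    congr 1
    ext m
    rw [hN, lp.coeFn_smul, Pi.smul_apply, smul_eq_mul, e_apply]
    split_ifs with hm <;> simp [hm]
  have hcomm : IsCommutator lam (N.trans U)
      ((N.trans U : EllTwo d →L[ℂ] EllTwo d) * D
        - ((ε : ℂ) • V) * (N.trans U : EllTwo d →L[ℂ] EllTwo d)) := by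
    have hND : (N : EllTwo d →L[ℂ] EllTwo d) * D = D * (N : EllTwo d →L[ℂ] EllTwo d) :=
      ext_entry fun m n => by
        rw [hNd.entry_mul, hNd.mul_entry]
        by_cases hmn : m = n
        · rw [hmn, mul_comm]
        · rw [hD m n hmn, mul_zero, zero_mul]
    have hUN : (N.trans U : EllTwo d →L[ℂ] EllTwo d)
        = (U : EllTwo d →L[ℂ] EllTwo d) * (N : EllTwo d →L[ℂ] EllTwo d) := rfl
    have := h.mul (hNd.isCommutator lam)
    rw [mul_zero, add_zero, sub_mul, mul_assoc, ← hND, ← mul_assoc, mul_assoc ((ε : ℂ) • V)]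
      at this
    rwa [hUN]
  have hconj := hcomm.conj_eq hD
  refine ⟨N.trans U, hconj, ⟨fun n => ?_, fun m n hmn => ?_⟩, fun n => ?_⟩
  · simp only [hNe, norm_smul, Complex.norm_real, norm_inv, norm_norm]
    exact inv_mul_cancel₀ (hpos n).ne'
  · exact inner_eq_zero_of_mem_eigenspace (inner_perturbed hV ε)
      (apply_e_mem_eigenspace hconj m) (apply_e_mem_eigenspace hconj n)
      (apply_e_ne_zero _ m) (hinj.ne hmn)
  · refine ⟨‖U (e n)‖⁻¹ * C, mul_pos (inv_pos.2 (hpos n)) hC, fun j => ?_⟩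
    rw [hNe, inner_smul_right, norm_mul, Complex.norm_real, norm_inv, norm_norm, mul_assoc]
    exact mul_le_mul_of_nonneg_left (norm_entry_le_of_shapeNorm_le hC.le hU j n)
      (inv_nonneg.2 (norm_nonneg _))

/-! ### Gaps of the limiting eigenvalues and the explicit constants. -/

theorem IsDiophantine.injective_add {lam : Lattice d → ℝ} {c γ : ℝ} (h : IsDiophantine lam c γ)
    {a : Lattice d → ℂ} (ha : seqNorm lam a ≤ ENNReal.ofReal (1 / (4 * c))) :
    Function.Injective fun n => (lam n : ℂ) + a n := by
  intro m n hmn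
  by_contra hne
  have hk : m - n ≠ 0 := sub_ne_zero.2 hne
  have h1 := h.abs_sub_le ha hk n
  have h2 := h.abs_sub_pos hk n
  rw [add_sub_cancel] at h1 h2
  have h3 : (lam m : ℂ) + a m - (lam n + a n) = 0 := sub_eq_zero.2 hmn
  rw [h3, norm_zero, mul_zero] at h1
  linarith

theorem IsDiophantine.inv_norm_sub_le' {lam : Lattice d → ℝ} {c γ : ℝ} (h : IsDiophantine lam c γ)
    {a : Lattice d → ℂ} (ha : seqNorm lam a ≤ ENNReal.ofReal (1 / (4 * c))) {m n : Lattice d}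
    (hmn : m ≠ n) :
    1 / ‖((lam m : ℂ) + a m) - (lam n + a n)‖ ≤ 12 * c ^ 2 * oneNorm (m - n) ^ (2 * γ) := by
  have hk : m - n ≠ 0 := sub_ne_zero.2 hmn
  have h1 := h.inv_norm_sub_le ha hk n
  rw [add_sub_cancel] at h1
  refine h1.trans ?_
  have hc := h.one_le
  have h2 : oneNorm (m - n) ^ γ ≤ oneNorm (m - n) ^ (2 * γ) :=
    Real.rpow_le_rpow_of_exponent_le (one_le_oneNorm hk) (by linarith [h.pos])
  have h3 : 2 * c ≤ 12 * c ^ 2 := by nlinarith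
  have h4 : 0 ≤ oneNorm (m - n) ^ γ := Real.rpow_nonneg (oneNorm_nonneg _) _
  exact mul_le_mul h3 h2 h4 (by positivity)

/-- The function `x * log (x / e)` has minimum `-1`, at `x = 1`, so `gConst γ ≥ 1 / e`. -/
theorem one_third_le_gConst {γ : ℝ} (hγ : 0 < γ) : 1 / 3 ≤ gConst γ := by
  have hx : 0 < 2 * γ := by linarith
  have h1 : (-1 : ℝ) ≤ Real.log (2 * γ / Real.exp 1) * (2 * γ) := by
    rw [Real.log_div hx.ne' (Real.exp_pos 1).ne', Real.log_exp]
    have := Real.one_sub_inv_le_log_of_pos hx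
    have h3 : (2 * γ)⁻¹ * (2 * γ) = 1 := inv_mul_cancel₀ hx.ne'
    nlinarith
  rw [gConst, Real.rpow_def_of_pos (by positivity)]
  refine le_trans ?_ (Real.exp_le_exp.2 h1)
  rw [Real.exp_neg, one_div]
  exact inv_anti₀ (Real.exp_pos 1) Real.exp_one_lt_three.le

theorem aConst_pos {c γ : ℝ} (hd : 1 ≤ d) (hc : 1 ≤ c) (hγ : 0 < γ) : 0 < aConst d c γ := by
  have hg := gConst_pos hγ
  have h1 : (3 : ℝ) ^ d / (2 : ℝ) ^ (6 * (d : ℤ) - 1) < 1 := by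
    have e : (2 : ℝ) ^ (6 * (d : ℤ) - 1) = 64 ^ d / 2 := by
      rw [zpow_sub₀ (by norm_num), zpow_mul, zpow_natCast, zpow_one]; norm_num
    rw [e, div_lt_one (by positivity), lt_div_iff₀ (by norm_num)]
    calc (3 : ℝ) ^ d * 2 ≤ 3 ^ d * 2 ^ d := by
          gcongr; exact le_self_pow₀ (by norm_num) (by omega)
      _ = 6 ^ d := by rw [← mul_pow]; norm_num
      _ < 64 ^ d := pow_lt_pow_left₀ (by norm_num) (by norm_num) (by omega)
  unfold aConst
  refine mul_pos (by positivity) (lt_min (by positivity) (by linarith))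

/-- The smallness conditions of the iteration follow from the explicit bound on the coupling. -/
theorem smallness_of_le {c γ σ E : ℝ} (hd : 1 ≤ d) (hc : 1 ≤ c) (hγ : 0 < γ) (hσ : 0 < σ)
    (hσ1 : σ ≤ 1) (hE : E ≤ aConst d c γ * σ ^ (4 * (d : ℝ) + 2 * γ)) :
    8 / 7 * E ≤ 1 / (4 * c) ∧
      4 * (12 * c ^ 2 * gConst γ) * 3 ^ d * σ ^ (-(2 * γ + d)) *
        ((2 : ℝ) ^ (2 * γ + d)) ^ 2 * E ≤ 1 / 4 := by
  have hG := one_third_le_gConst hγ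
  have hFeq : (2 : ℝ) ^ (4 * (2 * (d : ℝ) + γ)) = (4 : ℝ) ^ (4 * (d : ℝ) + 2 * γ) := by
    rw [show 4 * (2 * (d : ℝ) + γ) = 2 * (4 * d + 2 * γ) by ring, Real.rpow_mul (by norm_num)]
    norm_num
  have hF1 : (1 : ℝ) ≤ (4 : ℝ) ^ (4 * (d : ℝ) + 2 * γ) :=
    Real.one_le_rpow (by norm_num) (by positivity)
  -- This isolates the factor `K ^ 2` of the second smallness condition; the remaining `64 ^ d`
  -- beats `3 ^ d`.
  have hdecomp : (4 : ℝ) ^ (4 * (d : ℝ) + 2 * γ) = 64 ^ d * ((2 : ℝ) ^ (2 * γ + d)) ^ 2 := by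
    rw [← Real.rpow_natCast (_ ^ _) 2, ← Real.rpow_mul (by norm_num), ← Real.rpow_natCast 64 d,
      show (64 : ℝ) = 2 ^ (6 : ℝ) by norm_num, ← Real.rpow_mul (by norm_num),
      ← Real.rpow_add (by norm_num), show (4 : ℝ) = 2 ^ (2 : ℝ) by norm_num,
      ← Real.rpow_mul (by norm_num)]
    congr 1; push_cast; norm_num; ring
  have hA : aConst d c γ = 1 / (12 * c ^ 2 * gConst γ * (4 : ℝ) ^ (4 * (d : ℝ) + 2 * γ)) *
    min ((4 : ℝ) ^ (4 * (d : ℝ) + 2 * γ) * 3 * c * gConst γ /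
          (1 + (4 : ℝ) ^ (4 * (d : ℝ) + 2 * γ) * 3 * c * gConst γ))
        (1 - (3 : ℝ) ^ d / (2 : ℝ) ^ (6 * (d : ℤ) - 1)) := by
    rw [aConst, hFeq]
  set G := gConst γ
  set F : ℝ := (4 : ℝ) ^ (4 * (d : ℝ) + 2 * γ)
  have hG0 : 0 < G := by linarith
  have hF0 : 0 < F := by linarith
  set X := F * 3 * c * G with hX
  have hX1 : 1 ≤ X := by
    have h1 : 1 ≤ 3 * G := by linarith
    calc (1 : ℝ) = 1 * 1 * 1 := by norm_num
      _ ≤ F * c * (3 * G) := by gcongr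
      _ = X := by rw [hX]; ring
  have hA1 : aConst d c γ ≤ 1 / (12 * c ^ 2 * G * F) * (X / (1 + X)) := by
    rw [hA]; gcongr; exact min_le_left _ _
  have hA2 : aConst d c γ ≤ 1 / (12 * c ^ 2 * G * F) :=
    hA1.trans (mul_le_of_le_one_right (by positivity)
      ((div_le_one (by positivity)).2 (by linarith)))
  constructor
  · have hσp : σ ^ (4 * (d : ℝ) + 2 * γ) ≤ 1 := Real.rpow_le_one hσ.le hσ1 (by positivity)
    have h1 : E ≤ 1 / (12 * c ^ 2 * G * F) * (X / (1 + X)) := by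
      refine hE.trans ((mul_le_mul hA1 hσp (by positivity) (by positivity)).trans (by rw [mul_one]))
    -- The denominator `12 * c ^ 2 * G * F` equals `4 * c * X`. With `1 ≤ X` this leaves `E ≤ 1 / (8
    -- * c)`, enough for the factor 8/7.
    have h2 : 1 / (12 * c ^ 2 * G * F) * (X / (1 + X)) = 1 / (4 * c) * (1 / (1 + X)) := by
      rw [hX]; field_simp; norm_num
    have h3 : 1 / (1 + X) ≤ 1 / 2 := by gcongr; linarith
    have h4 : 1 / (4 * c) * (1 / (1 + X)) ≤ 1 / (4 * c) * (1 / 2) := by gcongr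
    have h5 : 0 < 1 / (4 * c) := by positivity
    linarith
  · have hσp : σ ^ (-(2 * γ + d)) * σ ^ (4 * (d : ℝ) + 2 * γ) ≤ 1 := by
      rw [← Real.rpow_add hσ]
      refine Real.rpow_le_one hσ.le hσ1 ?_
      have : (0 : ℝ) ≤ d := by positivity
      linarith
    have h1 : E ≤ 1 / (12 * c ^ 2 * G * F) * σ ^ (4 * (d : ℝ) + 2 * γ) :=
      hE.trans (by gcongr)
    have h3 : (3 / 64 : ℝ) ^ d ≤ 3 / 64 := pow_le_of_le_one (by norm_num) (by norm_num) (by omega)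
    calc _ ≤ 4 * (12 * c ^ 2 * G) * 3 ^ d * σ ^ (-(2 * γ + d)) *
        ((2 : ℝ) ^ (2 * γ + d)) ^ 2 * (1 / (12 * c ^ 2 * G * F) * σ ^ (4 * (d : ℝ) + 2 * γ)) := by
          gcongr
      _ = 4 * (3 / 64) ^ d * (σ ^ (-(2 * γ + d)) * σ ^ (4 * (d : ℝ) + 2 * γ)) := by
          rw [hdecomp, div_pow]; field_simp
      _ ≤ 4 * (3 / 64) * 1 := by gcongr
      _ ≤ 1 / 4 := by norm_num

theorem eq_zero_of_shapeNorm_eq_zero {lam : Lattice d → ℝ} {s : ℝ} {A : EllTwo d →L[ℂ] EllTwo d}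
    (h : shapeNorm lam s A = 0) : A = 0 := ext_entry fun m n => by
  have h1 : shapeNorm lam s A ≤ ENNReal.ofReal 0 := by simp [h]
  have := norm_entry_le_of_shapeNorm_le le_rfl h1 m n
  rw [zero_mul, norm_le_zero_iff] at this
  rw [this]; simp [entry_eq]

end PurePoint

end

/-! ### The main theorem. -/

theorem theorem2 (d : ℕ) (hd : 1 ≤ d)
    (lam : PurePoint.Lattice d → ℝ) (hlam : Function.Injective lam)
    (V : PurePoint.EllTwo d →L[ℂ] PurePoint.EllTwo d)
    (c γ α : ℝ) (hc : 1 ≤ c) (hγ : 0 < γ) (hα : 0 < α)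
    (h1 : ∀ k : PurePoint.Lattice d, k ≠ 0 → ∀ n : PurePoint.Lattice d,
      1 / |lam (n + k) - lam n| ≤ c * PurePoint.oneNorm k ^ γ)
    (h2 : ∀ k : PurePoint.Lattice d, k ≠ 0 → ∀ n : PurePoint.Lattice d,
      1 / |lam (n + k) - lam n| ≤ c * (1 + 1 / |lam k - lam 0|))
    (h3 : ∀ k : PurePoint.Lattice d, k ≠ 0 → ∀ n j : PurePoint.Lattice d, j ≠ 0 →
      |1 / (lam j - lam 0) *
          (1 / (lam (n + j + k) - lam (n + j)) - 1 / (lam (n + k) - lam n))|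
        ≤ c * (1 + 1 / |lam k - lam 0|))
    (h4 : PurePoint.shapeNorm lam α V < ⊤) :
    ∃ εstar : ℝ, 0 < εstar ∧
      (V ≠ 0 → εstar = PurePoint.aConst d c γ * min 1 (α / 2) ^ (4 * (d : ℝ) + 2 * γ) /
        (PurePoint.shapeNorm lam α V).toReal) ∧
      ∀ ε : ℝ, |ε| ≤ εstar →
        ∃ lamε : PurePoint.Lattice d → ℂ,
          -- pure point and simple spectrum, with distinct eigenvalues `lamε n`
          PurePoint.HasPurePointSpectrum
            (PurePoint.perturbed (PurePoint.diagOp fun n => (lam n : ℂ)) V ε) ∧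
          PurePoint.HasSimpleEigenvalues
            (PurePoint.perturbed (PurePoint.diagOp fun n => (lam n : ℂ)) V ε) ∧
          PurePoint.eigenvalues
            (PurePoint.perturbed (PurePoint.diagOp fun n => (lam n : ℂ)) V ε) = Set.range lamε ∧
          Function.Injective lamε ∧
          -- Diophantine condition
          (∀ m n : PurePoint.Lattice d, m ≠ n →
            1 / ‖lamε m - lamε n‖ ≤ 12 * c ^ 2 * PurePoint.oneNorm (m - n) ^ (2 * γ)) ∧
          -- diagonalization
          ∃ U : PurePoint.EllTwo d ≃L[ℂ] PurePoint.EllTwo d,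
            PurePoint.conj U
              (PurePoint.perturbed (PurePoint.diagOp fun n => (lam n : ℂ)) V ε)
                = PurePoint.diagOp lamε ∧
            -- the self-adjoint case
            (IsSelfAdjoint V →
              (U : PurePoint.EllTwo d →L[ℂ] PurePoint.EllTwo d) ∈
                  unitary (PurePoint.EllTwo d →L[ℂ] PurePoint.EllTwo d) ∧
              ∃ u : PurePoint.Lattice d → PurePoint.EllTwo d,
                Orthonormal ℂ u ∧
                (Submodule.span ℂ (Set.range u)).topologicalClosure = ⊤ ∧
                (∀ n, u n = U (PurePoint.e n)) ∧
                (∀ n, u n ∈ PurePoint.eigenspace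
                  (PurePoint.perturbed (PurePoint.diagOp fun n => (lam n : ℂ)) V ε) (lamε n)) ∧
                ∀ n, ∃ C : ℝ, 0 < C ∧ ∀ j : PurePoint.Lattice d,
                  ‖(inner ℂ (PurePoint.e j) (u n) : ℂ)‖ ≤
                    C * Real.exp (-((α - min 1 (α / 2)) * PurePoint.oneNorm (j - n)))) := by
  classical
  have h : PurePoint.IsDiophantine lam c γ := ⟨hlam, hc, hγ, h1, h2, h3⟩
  have hσ : 0 < min 1 (α / 2) := lt_min one_pos (by linarith)
  have hσ1 : min 1 (α / 2) ≤ 1 := min_le_left _ _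
  have hσα : 2 * min 1 (α / 2) ≤ α := by linarith [min_le_right 1 (α / 2)]
  have hA := PurePoint.aConst_pos hd hc hγ
  have hB : 0 < PurePoint.aConst d c γ * min 1 (α / 2) ^ (4 * (d : ℝ) + 2 * γ) := by positivity
  have hN : V ≠ 0 → 0 < (PurePoint.shapeNorm lam α V).toReal := fun hV =>
    ENNReal.toReal_pos (fun h0 => hV (PurePoint.eq_zero_of_shapeNorm_eq_zero h0)) h4.ne
  -- For `V = 0` any positive threshold works; 1 is a default.
  refine ⟨if V = 0 then 1 else PurePoint.aConst d c γ * min 1 (α / 2) ^ (4 * (d : ℝ) + 2 * γ) /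
    (PurePoint.shapeNorm lam α V).toReal, ?_, fun hV => if_neg hV, fun ε hε => ?_⟩
  · split_ifs with hV
    · exact one_pos
    · exact div_pos hB (hN hV)
  -- The iteration is run for `ε V`, and this product is its size `E`.
  have hE : |ε| * (PurePoint.shapeNorm lam α V).toReal
      ≤ PurePoint.aConst d c γ * min 1 (α / 2) ^ (4 * (d : ℝ) + 2 * γ) := by
    split_ifs at hε with hV
    · rw [hV, PurePoint.shapeNorm_zero, ENNReal.toReal_zero, mul_zero]
      exact hB.le
    · rwa [le_div_iff₀ (hN hV)] at hε
  obtain ⟨hE1, hE2⟩ := PurePoint.smallness_of_le hd hc hγ hσ hσ1 hE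
  have hεV : PurePoint.shapeNorm lam α ((ε : ℂ) • V)
      ≤ ENNReal.ofReal (|ε| * (PurePoint.shapeNorm lam α V).toReal) := by
    rw [PurePoint.shapeNorm_smul, ENNReal.ofReal_mul (abs_nonneg ε), ENNReal.ofReal_toReal h4.ne,
      ← ofReal_norm, Complex.norm_real, Real.norm_eq_abs]
  obtain ⟨D, U₀, hD, hDn, hcomm, ⟨u, rfl⟩, hUs⟩ := h.exists_conjugation hd hσ hσ1 hσα
    (by positivity) hE1 hE2 hεV
  obtain ⟨U, hU⟩ : ∃ U : PurePoint.EllTwo d ≃L[ℂ] PurePoint.EllTwo d,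
      (U : PurePoint.EllTwo d →L[ℂ] PurePoint.EllTwo d) = u := ⟨.ofUnit u, rfl⟩
  rw [← hU] at hcomm hUs
  have hdiag : (fun n => PurePoint.entry D n n) = PurePoint.diagonal D 0 := by
    funext n; simp [PurePoint.diagonal]
  rw [← hdiag] at hDn
  have hinj := h.injective_add hDn
  have hconj := hcomm.conj_eq hD
  refine ⟨fun n => (lam n : ℂ) + PurePoint.entry D n n, PurePoint.hasPurePointSpectrum hconj,
    PurePoint.hasSimpleEigenvalues hconj hinj, PurePoint.eigenvalues_eq hconj, hinj,
    fun m n hmn => h.inv_norm_sub_le' hDn hmn, ?_⟩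
  -- A single `U` has to serve both the conjugation and the unitarity claim, so the normalized one
  -- is chosen exactly when `V` is self-adjoint.
  by_cases hV : IsSelfAdjoint V
  · obtain ⟨U', hconj', horth, hdecay⟩ :=
      PurePoint.exists_unitary_conjugation hV hD hinj hcomm two_pos hUs
    exact ⟨U', hconj', fun _ => ⟨PurePoint.mem_unitary_of_orthonormal U' horth,
      fun n => U' (PurePoint.e n), horth, PurePoint.span_apply_e_dense U', fun _ => rfl,
      PurePoint.apply_e_mem_eigenspace hconj', hdecay⟩⟩
  · exact ⟨U, hconj, fun h => absurd h hV⟩
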